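/- **Theorem 1.4.** Let $G=(V,E)$ be a connected, locally finite graph (parallel edges and loops allowed), let $\Gamma$ be a subgroup of $\operatorname{Aut}(G)$ acting transitively on $V$, and let $0\in V$ be a fixed root. Let $\operatorname{Stab}_x y$ be the orbit of $y$ under the stabilizer of $x$ in $\Gamma$, let $\Delta(x,y)=|\operatorname{Stab}_y x|/|\operatorname{Stab}_x y|$ be the modular function, and suppose that $\Gamma$ is nonunimodular, i.e. $\Delta\not\equiv 1$. A self-avoiding walk (SAW) is a finite path in $G$ (with specified edges) visiting each vertex at most once; $|\omega|$ and $\omega^+$ denote the length and the last vertex of $\omega$, and $d$ is the graph distance. For $\lambda\in\mathbb R$, $n\ge 0$, $z\ge 0$ and $x\in V$ let $$Z(\lambda;n)=\sum_{\omega \text{ SAW from } 0,\ |\omega|=n}\Delta(0,\omega^+)^\lambda,\qquad \chi(z,\lambda)=\sum_{n\ge0}z^nZ(\lambda;n),\qquad G(z;x)=\sum_{\omega \text{ SAW from } 0 \text{ to } x}z^{|\omega|},$$ let $$\mu_{c,\lambda}=\lim_{n\to\infty}Z(\lambda;n)^{1/n}=\inf_{n\ge1}Z(\lambda;n)^{1/n}$$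 (for every $\lambda\in\mathbb R$ the limit exists, equals the infimum, and is positive), $z_{c,\lambda}=\mu_{c,\lambda}^{-1}$ and $z_t=z_{c,1/2}$. Let $\mathbf P_{\lambda,n}$ be the probability measure on SAWs of length $n$ from $0$ with $\mathbf P_{\lambda,n}(\{\omega\})=Z(\lambda;n)^{-1}\Delta(0,\omega^+)^\lambda$, and write $X_n$ for the last vertex of the random walk. Then the following hold. 1. For every $\lambda\ne 1/2$ there exists a constant $C_\lambda>0$ such that $$\frac{z_{c,\lambda}}{z_{c,\lambda}-z}\le\chi(z,\lambda)\le\frac{C_\lambda z_{c,\lambda}}{z_{c,\lambda}-z}\quad\text{and}\quad \mu_{c,\lambda}^n\le Z(\lambda;n)\le C_\lambda\mu_{c,\lambda}^n$$ for every $0<z<z_{c,\lambda}$ and every $n\ge0$. 2. For every $z\in[0,z_t)$ there exist constants $c_z>0$ and $C_z>0$ such that $G(z;x)\le C_z e^{-c_z d(0,x)}$ for every $x\in V$. 3. For every $\lambda\neq1/2$ there exist constants $c_\lambda,c'_\lambda>0$ such that $$\mathbf P_{\lambda,n}\bigl[\operatorname{sgn}(\lambda-1/2)\log\Delta(0,X_n)\ge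 c_\lambda n\bigr]\ge1-e^{-c_\lambda n}\quad\text{and}\quad \mathbf P_{\lambda,n}\bigl[d(0,X_n)\ge c'_\lambda n\bigr]\ge1-e^{-c'_\lambda n}$$ for every $n\ge0$. -/

import Mathlib

open Filter Topology
open scoped ENNReal

/-- A graph, possibly with parallel edges and loops, with vertex set `V` and set of oriented
edges `D`. The oriented edge `e` starts at `src e`, and `rev e` is its reversal; every unoriented
edge corresponds to exactly two oriented edges. -/
structure MGraph (V D : Type*) where
  src : D → V
  rev : D → D
  rev_rev : ∀ e, rev (rev e) = e
  rev_ne : ∀ e, rev e ≠ e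

namespace MGraph

variable {V D : Type*} (G : MGraph V D)

/-- The vertex at which the oriented edge `e` ends. -/
def tgt (e : D) : V := G.src (G.rev e)

/-- `G.IsPath x p`: the list `p` of oriented edges is the edge sequence of a path in `G` starting
at `x`. Its length is `p.length`. -/
def IsPath : V → List D → Prop
  | _, [] => True
  | x, e :: p => G.src e = x ∧ IsPath (G.tgt e) p

/-- The last vertex of the path starting at `x` with edge sequence `p`. -/
def endpoint : V → List D → V
  | x, [] => x
  | _, e :: p => endpoint (G.tgt e) p

/-- The path starting at `x` with edge sequence `p` visits every vertex at most once. -/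
def IsSAW (x : V) (p : List D) : Prop :=
  G.IsPath x p ∧ (x :: p.map G.tgt).Nodup

/-- The self-avoiding walks of length `n` starting at `x`. -/
def sawSet (x : V) (n : ℕ) : Set (List D) := {p | G.IsSAW x p ∧ p.length = n}

def Connected : Prop := ∀ x y : V, ∃ p, G.IsPath x p ∧ G.endpoint x p = y

def LocallyFinite : Prop := ∀ x : V, {e | G.src e = x}.Finite

/-- Graph distance (meaningful for connected graphs). -/
noncomputable def dist (x y : V) : ℕ :=
  sInf {n | ∃ p, G.IsPath x p ∧ G.endpoint x p = y ∧ p.length = n}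

/-- The automorphism group: pairs of a permutation of the vertices and a permutation of the
oriented edges that respect starting points and reversal (hence also end points). -/
def aut : Subgroup (Equiv.Perm V × Equiv.Perm D) where
  carrier := {γ | ∀ e, G.src (γ.2 e) = γ.1 (G.src e) ∧ G.rev (γ.2 e) = γ.2 (G.rev e)}
  mul_mem' := by
    intro a b ha hb e
    refine ⟨?_, ?_⟩
    · simp [(ha (b.2 e)).1, (hb e).1]
    · simp [(ha (b.2 e)).2, (hb e).2]
  one_mem' := by
    intro e
    simp
  inv_mem' := by
    intro a ha e
    refine ⟨?_, ?_⟩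
    · have h := (ha (a.2⁻¹ e)).1
      rw [show a.2 (a.2⁻¹ e) = e from a.2.apply_symm_apply e] at h
      exact (a.1.symm_apply_eq.2 h).symm
    · have h := (ha (a.2⁻¹ e)).2
      rw [show a.2 (a.2⁻¹ e) = e from a.2.apply_symm_apply e] at h
      exact (a.2.symm_apply_eq.2 h).symm

end MGraph

section Group

variable {V D : Type*} (Γ : Subgroup (Equiv.Perm V × Equiv.Perm D))

/-- `Γ` acts transitively on the vertices. -/
def VertexTransitive : Prop := ∀ x y : V, ∃ γ ∈ Γ, γ.1 x = y

/-- `Stab_x y`: the orbit of `y` under the stabilizer of `x` in `Γ`. -/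
def stabOrbit (x y : V) : Set V := {v | ∃ γ ∈ Γ, γ.1 x = x ∧ γ.1 y = v}

/-- The modular function `Δ(x, y) = |Stab_y x| / |Stab_x y|`. -/
noncomputable def modular (x y : V) : ℝ :=
  ((stabOrbit Γ y x).ncard : ℝ) / ((stabOrbit Γ x y).ncard : ℝ)

def Unimodular : Prop := ∀ x y : V, modular Γ x y = 1

end Group

namespace MGraph

variable {V D : Type*} (G : MGraph V D) (Γ : Subgroup (Equiv.Perm V × Equiv.Perm D)) (o : V)

/-- `Z(lam; n)`: the sum of `Δ(o, X_n) ^ lam` over all self-avoiding walks `X` of length `n`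
starting at `o` (a finite sum when `G` is locally finite). -/
noncomputable def tiltedZ (lam : ℝ) (n : ℕ) : ℝ :=
  ∑' p : G.sawSet o n, modular Γ o (G.endpoint o p) ^ lam

/-- `μ_{c,lam} = inf_{n ≥ 1} Z(lam; n)^{1/n}`. -/
noncomputable def muc (lam : ℝ) : ℝ :=
  ⨅ n : ℕ, G.tiltedZ Γ o lam (n + 1) ^ (1 / ((n + 1 : ℕ) : ℝ))

/-- The critical point `z_{c,lam} = 1 / μ_{c,lam}`. -/
noncomputable def zc (lam : ℝ) : ℝ := (G.muc Γ o lam)⁻¹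

/-- The tilted susceptibility `χ(z, lam)`, for `z ≥ 0`, as an element of `[0, ∞]`. -/
noncomputable def tiltedChi (z lam : ℝ) : ℝ≥0∞ :=
  ∑' n : ℕ, ENNReal.ofReal (z ^ n * G.tiltedZ Γ o lam n)

/-- The two-point function `G(z; x)`, for `z ≥ 0`, as an element of `[0, ∞]`. -/
noncomputable def twoPoint (z : ℝ) (x : V) : ℝ≥0∞ :=
  ∑' p : {p : List D // G.IsSAW o p ∧ G.endpoint o p = x}, ENNReal.ofReal (z ^ p.1.length)

/-- The probability of the event `A` when the self-avoiding walk `p` of length `n` starting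
at `o` is chosen with probability `Z(lam; n)⁻¹ Δ(o, p⁺) ^ lam`. -/
noncomputable def tiltedProb (lam : ℝ) (n : ℕ) (A : Set (List D)) : ℝ :=
  ∑' p : G.sawSet o n,
    A.indicator (fun q => (G.tiltedZ Γ o lam n)⁻¹ * modular Γ o (G.endpoint o q) ^ lam) p

end MGraph

/-!
# Self-avoiding walk on nonunimodular transitive graphs

Walks are weighted by `z ^ n * exp (lam * h)`, where `h = log Δ` is regarded as a height function:
it is an additive cocycle that `Γ` leaves invariant. The mass-transport principle
(`mass_transport`) and the reversal of walks exchange the tilts `lam` and `1 - lam`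
(`gf_le_gf_of_revPath`), so `1/2` is the symmetric point. Everything rests on the strict inequality
`μ_{1/2} < μ_lam` for `lam ≠ 1/2` (`muc_half_lt`).

A bridge is a walk that stays strictly above its start and ends at a highest vertex. If every
bridge is the concatenation of an element of a set `C` of bridges and another bridge in at most one
way, then prepending an element of `C` injects `C × {bridges}` into the bridges, and the generating
function of `C` is at most one wherever that of all bridges is finite
(`gf_le_one_of_prefix_unique`). This holds for the bridges of a fixed length and, since two
cutting points of a bridge differ in height by at least the smallest positive step `δ`, also for
the bridges with height in an interval of length `δ`.

For the strict inequality, suppose `lam > 1/2` and `μ_lam ≤ μ_{1/2}`. Changing the tilt from `lam`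
to `1/2` shows that for all `z < 1 / μ_{1/2}` the bridges at tilt `1/2` with height in
`[k δ, (k + 1) δ)` have generating function at most `ρ ^ k`, where `ρ < 1` does not depend on `z`.
By the symmetry the same holds for downward bridges. The Hammersley–Welsh decomposition of a
half-space walk into bridges of decreasing heights becomes the recursion
`T (k + 1) ≤ T k + ρ ^ k * T (k + 1)`, so half-space walks have bounded generating function
(`gf_above_le`). Cutting a walk at its maximum bounds the susceptibility by the square of that
generating function, up to a constant. This contradicts the divergence of the susceptibility at
`1 / μ_{1/2}`.

Given the strict inequality, the conclusions are short. A walk is a bridge between its extrema with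
a descending walk attached at either end; at tilt `lam > 1/2` the descending walks of all lengths
contribute at most the susceptibility at tilt `1/2`, finite at `1 / μ_lam`, and bridges of length
`n` contribute at most `μ_lam ^ n` (`gf_saw_ofLength_le`). The two-point function is bounded by the
susceptibility at tilt `1/2` after reversing the walk if necessary, and ballisticity is Chernoff's
bound against the tilt `1/2`.
-/

namespace MGraph

variable {V D : Type*} (G : MGraph V D) {Γ : Subgroup (Equiv.Perm V × Equiv.Perm D)}

/-! ### Concatenation, reversal and translation of paths -/

@[simp] lemma tgt_rev (e : D) : G.tgt (G.rev e) = G.src e := by simp [tgt, G.rev_rev]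

@[simp] lemma src_rev (e : D) : G.src (G.rev e) = G.tgt e := rfl

lemma isPath_append (x : V) (a b : List D) :
    G.IsPath x (a ++ b) ↔ G.IsPath x a ∧ G.IsPath (G.endpoint x a) b := by
  induction a generalizing x with
  | nil => simp [IsPath, endpoint]
  | cons e a ih => simp [IsPath, endpoint, ih, and_assoc]

lemma endpoint_append (x : V) (a b : List D) :
    G.endpoint x (a ++ b) = G.endpoint (G.endpoint x a) b := by
  induction a generalizing x with
  | nil => simp [endpoint]
  | cons e a ih => simp [endpoint, ih]

lemma endpoint_mem (x : V) (p : List D) : G.endpoint x p ∈ x :: p.map G.tgt := by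
  induction p generalizing x with
  | nil => simp [endpoint]
  | cons e p ih =>
    have := ih (G.tgt e)
    simp only [endpoint, List.map_cons]
    exact List.mem_cons_of_mem _ this

lemma isSAW_append (x : V) (a b : List D) :
    G.IsSAW x (a ++ b) ↔ G.IsSAW x a ∧ G.IsSAW (G.endpoint x a) b ∧
      ∀ e ∈ b, G.tgt e ∉ x :: a.map G.tgt := by
  have key : (x :: (a ++ b).map G.tgt).Nodup ↔ (x :: a.map G.tgt).Nodup ∧
      (b.map G.tgt).Nodup ∧ ∀ e ∈ b, G.tgt e ∉ x :: a.map G.tgt := by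
    rw [List.map_append, ← List.cons_append, List.nodup_append']
    refine and_congr_right fun _ => and_congr_right fun _ => ?_
    constructor
    · intro h e he h'
      exact h h' (List.mem_map_of_mem he)
    · intro h v hv hv'
      obtain ⟨e, he, rfl⟩ := List.mem_map.1 hv'
      exact h e he hv
  have hend := G.endpoint_mem x a
  unfold IsSAW
  rw [isPath_append, key, List.nodup_cons (a := G.endpoint x a)]
  constructor
  · rintro ⟨⟨h1, h2⟩, h3, h4, h5⟩
    refine ⟨⟨h1, h3⟩, ⟨h2, ?_, h4⟩, h5⟩
    intro h
    obtain ⟨e, he, h'⟩ := List.mem_map.1 h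
    exact h5 e he (h' ▸ hend)
  · rintro ⟨⟨h1, h3⟩, ⟨h2, -, h4⟩, h5⟩
    exact ⟨⟨h1, h2⟩, h3, h4, h5⟩

@[simp] lemma isSAW_nil (x : V) : G.IsSAW x [] := by simp [IsSAW, IsPath]

/-- The edge sequence of the path `p` traversed backwards. -/
def revPath (p : List D) : List D := (p.map G.rev).reverse

@[simp] lemma revPath_revPath (p : List D) : G.revPath (G.revPath p) = p := by
  simp only [revPath, List.map_reverse, List.reverse_reverse, List.map_map]
  rw [show G.rev ∘ G.rev = id from funext G.rev_rev, List.map_id]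

@[simp] lemma length_revPath (p : List D) : (G.revPath p).length = p.length := by
  simp [revPath]

lemma revPath_cons (e : D) (p : List D) : G.revPath (e :: p) = G.revPath p ++ [G.rev e] := by
  simp [revPath]

lemma endpoint_revPath {x : V} {p : List D} (hp : G.IsPath x p) :
    G.endpoint (G.endpoint x p) (G.revPath p) = x := by
  induction p generalizing x with
  | nil => rfl
  | cons e p ih => simpa [revPath_cons, endpoint_append, endpoint, ih hp.2] using hp.1

lemma isPath_revPath {x : V} {p : List D} (hp : G.IsPath x p) :
    G.IsPath (G.endpoint x p) (G.revPath p) := by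
  induction p generalizing x with
  | nil => trivial
  | cons e p ih =>
    rw [revPath_cons, isPath_append]
    refine ⟨ih hp.2, ?_⟩
    simp [IsPath, endpoint, G.endpoint_revPath hp.2]

lemma vertices_revPath {x : V} {p : List D} (hp : G.IsPath x p) :
    G.endpoint x p :: (G.revPath p).map G.tgt = (x :: p.map G.tgt).reverse := by
  induction p generalizing x with
  | nil => rfl
  | cons e p ih =>
    have := ih hp.2
    simp only [endpoint, revPath_cons, List.map_append, List.map_cons, tgt_rev, List.map_nil,
      List.reverse_cons (a := x)]
    rw [← List.cons_append, this, hp.1]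

lemma isSAW_revPath {x : V} {p : List D} (hp : G.IsSAW x p) :
    G.IsSAW (G.endpoint x p) (G.revPath p) :=
  ⟨G.isPath_revPath hp.1, by rw [G.vertices_revPath hp.1]; exact List.nodup_reverse.2 hp.2⟩

lemma tgt_map {γ : Equiv.Perm V × Equiv.Perm D} (hγ : γ ∈ G.aut) (e : D) :
    G.tgt (γ.2 e) = γ.1 (G.tgt e) := by
  rw [tgt, (hγ e).2, (hγ _).1, tgt]

lemma endpoint_map {γ : Equiv.Perm V × Equiv.Perm D} (hγ : γ ∈ G.aut) (x : V) (p : List D) :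
    G.endpoint (γ.1 x) (p.map γ.2) = γ.1 (G.endpoint x p) := by
  induction p generalizing x with
  | nil => rfl
  | cons e p ih => simp [endpoint, G.tgt_map hγ, ih]

lemma isPath_map {γ : Equiv.Perm V × Equiv.Perm D} (hγ : γ ∈ G.aut) {x : V} {p : List D}
    (hp : G.IsPath x p) : G.IsPath (γ.1 x) (p.map γ.2) := by
  induction p generalizing x with
  | nil => trivial
  | cons e p ih =>
    refine ⟨by rw [(hγ e).1, hp.1], ?_⟩
    rw [G.tgt_map hγ]
    exact ih hp.2

lemma isSAW_map {γ : Equiv.Perm V × Equiv.Perm D} (hγ : γ ∈ G.aut) {x : V} {p : List D}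
    (hp : G.IsSAW x p) : G.IsSAW (γ.1 x) (p.map γ.2) := by
  refine ⟨G.isPath_map hγ hp.1, ?_⟩
  have : γ.1 x :: (p.map γ.2).map G.tgt = (x :: p.map G.tgt).map γ.1 := by
    simp [Function.comp_def, G.tgt_map hγ]
  rw [this]
  exact hp.2.map γ.1.injective

/-! ### Height functions and generating functions of walks -/

/-- `h x y` is a `Γ`-invariant height difference between `x` and `y`. The examples are
`log Δ` and `-log Δ`. -/
structure IsHeight (Γ : Subgroup (Equiv.Perm V × Equiv.Perm D)) (h : V → V → ℝ) : Prop where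
  add : ∀ x y w, h x y + h y w = h x w
  inv : ∀ γ ∈ Γ, ∀ x y, h (γ.1 x) (γ.1 y) = h x y

lemma IsHeight.self {h : V → V → ℝ} (hh : IsHeight Γ h) (x : V) : h x x = 0 := by
  have := hh.add x x x
  linarith

lemma IsHeight.swap {h : V → V → ℝ} (hh : IsHeight Γ h) (x y : V) : h y x = -h x y := by
  have := hh.add x y x
  rw [hh.self] at this
  linarith

lemma IsHeight.neg {h : V → V → ℝ} (hh : IsHeight Γ h) : IsHeight Γ (-h) where
  add x y w := by
    have := hh.add x y w
    simp only [Pi.neg_apply]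
    linarith
  inv γ hγ x y := by simp only [Pi.neg_apply, hh.inv γ hγ]

/-- A family of sets of walks, one for each starting vertex, that `Γ` permutes. -/
def Equivariant (Γ : Subgroup (Equiv.Perm V × Equiv.Perm D)) (S : V → Set (List D)) : Prop :=
  ∀ γ ∈ Γ, ∀ x, ∀ p ∈ S x, p.map γ.2 ∈ S (γ.1 x)

/-- The weight `z ^ |p| * exp (lam * h)` of the walk `p` from `x`, where `h` is the height
difference between its two ends. -/
noncomputable def wt (h : V → V → ℝ) (z lam : ℝ) (x : V) (p : List D) : ℝ≥0∞ :=
  ENNReal.ofReal (z ^ p.length * Real.exp (lam * h x (G.endpoint x p)))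

/-- The generating function of the walks from `x` that belong to the family `S`. -/
noncomputable def gf (h : V → V → ℝ) (z lam : ℝ) (S : V → Set (List D)) (x : V) : ℝ≥0∞ :=
  ∑' p : S x, G.wt h z lam x p

variable {G} {h : V → V → ℝ} {z lam : ℝ} {S T A B : V → Set (List D)} {x : V}

lemma wt_append (hh : IsHeight Γ h) (hz : 0 ≤ z) (x : V) (a b : List D) :
    G.wt h z lam x (a ++ b) = G.wt h z lam x a * G.wt h z lam (G.endpoint x a) b := by
  unfold wt
  rw [← ENNReal.ofReal_mul (by positivity), endpoint_append, ← hh.add x (G.endpoint x a),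
    List.length_append, pow_add, mul_add, Real.exp_add]
  congr 1
  ring

lemma wt_map (hΓ : Γ ≤ G.aut) (hh : IsHeight Γ h) {γ : Equiv.Perm V × Equiv.Perm D}
    (hγ : γ ∈ Γ) (x : V) (p : List D) :
    G.wt h z lam (γ.1 x) (p.map γ.2) = G.wt h z lam x p := by
  simp only [wt, List.length_map, G.endpoint_map (hΓ hγ), hh.inv γ hγ]

lemma wt_neg (h : V → V → ℝ) (z lam : ℝ) (x : V) (p : List D) :
    G.wt (-h) z (-lam) x p = G.wt h z lam x p := by
  simp [wt]

lemma gf_neg (h : V → V → ℝ) (z lam : ℝ) (S : V → Set (List D)) (x : V) :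
    G.gf (-h) z (-lam) S x = G.gf h z lam S x := by
  simp only [gf, wt_neg]

lemma gf_mono (hST : S x ⊆ T x) : G.gf h z lam S x ≤ G.gf h z lam T x :=
  ENNReal.tsum_mono_subtype _ hST

lemma gf_le_add (hST : S x ⊆ A x ∪ B x) :
    G.gf h z lam S x ≤ G.gf h z lam A x + G.gf h z lam B x :=
  (ENNReal.tsum_mono_subtype _ hST).trans (ENNReal.tsum_union_le _ _ _)

lemma gf_le_gf_of_wt_le {lam' : ℝ} {c : ℝ≥0∞}
    (hle : ∀ p ∈ S x, G.wt h z lam x p ≤ c * G.wt h z lam' x p) :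
    G.gf h z lam S x ≤ c * G.gf h z lam' S x := by
  unfold gf
  rw [← ENNReal.tsum_mul_left]
  exact ENNReal.tsum_le_tsum fun p => hle p p.2

lemma gf_eq_gf (hΓ : Γ ≤ G.aut) (htrans : VertexTransitive Γ) (hh : IsHeight Γ h)
    (hS : Equivariant Γ S) (x y : V) : G.gf h z lam S x = G.gf h z lam S y := by
  have key : ∀ x y, G.gf h z lam S x ≤ G.gf h z lam S y := by
    intro x y
    obtain ⟨γ, hγ, rfl⟩ := htrans x y
    let f : S x → S (γ.1 x) := fun p => ⟨p.1.map γ.2, hS γ hγ x p p.2⟩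
    have hf : Function.Injective f := by
      intro p q hpq
      exact Subtype.ext (List.map_injective_iff.2 γ.2.injective (congrArg Subtype.val hpq))
    calc G.gf h z lam S x = ∑' p : S x, G.wt h z lam (γ.1 x) (f p) :=
          tsum_congr fun p => (wt_map hΓ hh hγ x p).symm
      _ ≤ _ := ENNReal.tsum_comp_le_tsum_of_injective hf _
  exact le_antisymm (key x y) (key y x)

/-- Cutting walks in two: if every walk in `S` is a walk `a ∈ A` followed by a walk in `B a`,
then the generating function of `S` is at most the sum over `a` of the products. -/
lemma gf_le_tsum_of_split (hh : IsHeight Γ h) (hz : 0 ≤ z) {B : List D → V → Set (List D)}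
    (f : List D → ℝ≥0∞)
    (hsplit : ∀ p ∈ S x, ∃ a ∈ A x, ∃ b ∈ B a (G.endpoint x a), p = a ++ b)
    (hB : ∀ a ∈ A x, G.gf h z lam (B a) (G.endpoint x a) ≤ f a) :
    G.gf h z lam S x ≤ ∑' a : A x, G.wt h z lam x a * f a := by
  choose! a ha b hb hab using hsplit
  let F : S x → Σ a : A x, B a (G.endpoint x a) :=
    fun p => ⟨⟨a p, ha p p.2⟩, ⟨b p, hb p p.2⟩⟩
  have hF : Function.Injective F := by
    have hval : ∀ p : S x, p.1 = (F p).1.1 ++ (F p).2.1 := fun p => hab p p.2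
    intro p q hpq
    refine Subtype.ext ?_
    rw [hval p, hval q, hpq]
  calc G.gf h z lam S x
      = ∑' p : S x, (fun s : Σ a : A x, B a (G.endpoint x a) =>
          G.wt h z lam x s.1 * G.wt h z lam (G.endpoint x s.1) s.2) (F p) := by
        refine tsum_congr fun p => ?_
        conv_lhs => rw [hab p p.2, wt_append hh hz]
    _ ≤ ∑' s : Σ a : A x, B a (G.endpoint x a),
          G.wt h z lam x s.1 * G.wt h z lam (G.endpoint x s.1) s.2 :=
        ENNReal.tsum_comp_le_tsum_of_injective hF _
    _ = ∑' a : A x, G.wt h z lam x a * G.gf h z lam (B a) (G.endpoint x a) := by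
        rw [ENNReal.tsum_sigma']
        exact tsum_congr fun a => ENNReal.tsum_mul_left (a := G.wt h z lam x a)
    _ ≤ _ := ENNReal.tsum_le_tsum fun a => by gcongr; exact hB a a.2

lemma gf_le_mul (hΓ : Γ ≤ G.aut) (htrans : VertexTransitive Γ) (hh : IsHeight Γ h) (hz : 0 ≤ z)
    (hB : Equivariant Γ B) (hsplit : ∀ p ∈ S x, ∃ a ∈ A x, ∃ b ∈ B (G.endpoint x a), p = a ++ b) :
    G.gf h z lam S x ≤ G.gf h z lam A x * G.gf h z lam B x := by
  refine (gf_le_tsum_of_split hh hz (B := fun _ => B) (fun _ => G.gf h z lam B x) hsplit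
    fun a _ => (gf_eq_gf hΓ htrans hh hB _ _).le).trans ?_
  rw [ENNReal.tsum_mul_right, ← gf]

/-- Concatenating walks: if `a ++ b` lies in `S` for `a ∈ A` and `b ∈ B`, and determines `a`,
then the product of the generating functions of `A` and `B` is at most that of `S`. -/
lemma mul_le_gf (hΓ : Γ ≤ G.aut) (htrans : VertexTransitive Γ) (hh : IsHeight Γ h) (hz : 0 ≤ z)
    (hB : Equivariant Γ B) (hcat : ∀ a ∈ A x, ∀ b ∈ B (G.endpoint x a), a ++ b ∈ S x)
    (hinj : ∀ a ∈ A x, ∀ b ∈ B (G.endpoint x a), ∀ a' ∈ A x, ∀ b' ∈ B (G.endpoint x a'),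
      a ++ b = a' ++ b' → a = a') :
    G.gf h z lam A x * G.gf h z lam B x ≤ G.gf h z lam S x := by
  let F : (Σ a : A x, B (G.endpoint x a)) → S x :=
    fun s => ⟨s.1 ++ s.2, hcat s.1 s.1.2 s.2 s.2.2⟩
  have hF : Function.Injective F := by
    rintro ⟨⟨a, ha⟩, ⟨b, hb⟩⟩ ⟨⟨a', ha'⟩, ⟨b', hb'⟩⟩ heq
    have heq : a ++ b = a' ++ b' := congrArg Subtype.val heq
    obtain rfl := hinj a ha b hb a' ha' b' hb' heq
    obtain rfl := List.append_cancel_left heq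
    rfl
  calc G.gf h z lam A x * G.gf h z lam B x
      = ∑' a : A x, G.wt h z lam x a * G.gf h z lam B (G.endpoint x a) := by
        rw [gf, ← ENNReal.tsum_mul_right]
        exact tsum_congr fun a => by rw [gf_eq_gf hΓ htrans hh hB x (G.endpoint x a)]
    _ = ∑' s : Σ a : A x, B (G.endpoint x a),
          G.wt h z lam x s.1 * G.wt h z lam (G.endpoint x s.1) s.2 := by
        rw [ENNReal.tsum_sigma']
        exact tsum_congr fun a => ENNReal.tsum_mul_left.symm
    _ = ∑' s : Σ a : A x, B (G.endpoint x a), G.wt h z lam x (F s) :=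
        tsum_congr fun s => (wt_append hh hz _ _ _).symm
    _ ≤ _ := ENNReal.tsum_comp_le_tsum_of_injective hF _

/-- The walks of length `n` in the family `S`. -/
def ofLength (S : V → Set (List D)) (n : ℕ) (x : V) : Set (List D) := {p | p ∈ S x ∧ p.length = n}

lemma Equivariant.ofLength (hS : Equivariant Γ S) (n : ℕ) : Equivariant Γ (ofLength S n) :=
  fun γ hγ x p hp => ⟨hS γ hγ x p hp.1, by simpa using hp.2⟩

lemma tsum_ofLength (S : V → Set (List D)) (x : V) (F : List D → ℝ≥0∞) :
    ∑' n, ∑' p : ofLength S n x, F p = ∑' p : S x, F p := by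
  rw [← ENNReal.tsum_sigma' (f := fun s : Σ n, ofLength S n x => F s.2)]
  let e : (Σ n, ofLength S n x) ≃ S x :=
    { toFun := fun s => ⟨s.2, s.2.2.1⟩
      invFun := fun p => ⟨p.1.length, ⟨p, p.2, rfl⟩⟩
      left_inv := by rintro ⟨n, ⟨p, hp, rfl⟩⟩; rfl
      right_inv := fun p => rfl }
  exact e.tsum_eq (fun p : S x => F p)

lemma gf_eq_tsum_ofLength : G.gf h z lam S x = ∑' n, G.gf h z lam (ofLength S n) x :=
  (tsum_ofLength S x _).symm

end MGraph

namespace MGraph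

variable {V D : Type*} (G : MGraph V D) {Γ : Subgroup (Equiv.Perm V × Equiv.Perm D)}

/-! ### Bridges and half-space walks -/

/-- All self-avoiding walks from `x`. -/
def saw (x : V) : Set (List D) := {p | G.IsSAW x p}

/-- Bridges: self-avoiding walks that stay strictly above their starting point after the start
and end at a highest vertex. Because the lower inequality is strict, concatenations of bridges
are bridges. -/
def bridge (h : V → V → ℝ) (x : V) : Set (List D) :=
  {p | G.IsSAW x p ∧ ∀ e ∈ p, 0 < h x (G.tgt e) ∧ h x (G.tgt e) ≤ h x (G.endpoint x p)}

/-- Bridges whose height lies in `[s, t)`. -/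
def bridgeIn (h : V → V → ℝ) (s t : ℝ) (x : V) : Set (List D) :=
  {p | p ∈ G.bridge h x ∧ s ≤ h x (G.endpoint x p) ∧ h x (G.endpoint x p) < t}

/-- Self-avoiding walks that end at a highest vertex. -/
def toMax (h : V → V → ℝ) (x : V) : Set (List D) :=
  {p | G.IsSAW x p ∧ 0 ≤ h x (G.endpoint x p) ∧ ∀ e ∈ p, h x (G.tgt e) ≤ h x (G.endpoint x p)}

/-- Self-avoiding walks that end at most as high as they start. -/
def descent (h : V → V → ℝ) (x : V) : Set (List D) :=
  {p | G.IsSAW x p ∧ h x (G.endpoint x p) ≤ 0}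

/-- Self-avoiding walks in the closed half-space below the starting point. -/
def below (h : V → V → ℝ) (x : V) : Set (List D) :=
  {p | G.IsSAW x p ∧ ∀ e ∈ p, h x (G.tgt e) ≤ 0}

/-- Self-avoiding walks that stay in the open half-space above the starting point after the
start. -/
def above (h : V → V → ℝ) (x : V) : Set (List D) :=
  {p | G.IsSAW x p ∧ ∀ e ∈ p, 0 < h x (G.tgt e)}

/-- Walks in `above` that reach only heights less than `t`. -/
def aboveLt (h : V → V → ℝ) (t : ℝ) (x : V) : Set (List D) :=
  {p | G.IsSAW x p ∧ ∀ e ∈ p, 0 < h x (G.tgt e) ∧ h x (G.tgt e) < t}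

variable {G} {h : V → V → ℝ} {z lam : ℝ} {x : V}

lemma equivariant_saw (hΓ : Γ ≤ G.aut) : Equivariant Γ G.saw :=
  fun _ hγ _ _ hp => G.isSAW_map (hΓ hγ) hp

lemma equivariant_bridge (hΓ : Γ ≤ G.aut) (hh : IsHeight Γ h) : Equivariant Γ (G.bridge h) := by
  intro γ hγ x p hp
  refine ⟨G.isSAW_map (hΓ hγ) hp.1, ?_⟩
  simpa [List.forall_mem_map, G.tgt_map (hΓ hγ), G.endpoint_map (hΓ hγ), hh.inv γ hγ] using hp.2

lemma equivariant_descent (hΓ : Γ ≤ G.aut) (hh : IsHeight Γ h) :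
    Equivariant Γ (G.descent h) := by
  intro γ hγ x p hp
  refine ⟨G.isSAW_map (hΓ hγ) hp.1, ?_⟩
  simpa [G.endpoint_map (hΓ hγ), hh.inv γ hγ] using hp.2

lemma equivariant_toMax (hΓ : Γ ≤ G.aut) (hh : IsHeight Γ h) :
    Equivariant Γ (G.toMax h) := by
  intro γ hγ x p hp
  refine ⟨G.isSAW_map (hΓ hγ) hp.1, ?_⟩
  simpa [List.forall_mem_map, G.tgt_map (hΓ hγ), G.endpoint_map (hΓ hγ), hh.inv γ hγ] using hp.2

lemma equivariant_below (hΓ : Γ ≤ G.aut) (hh : IsHeight Γ h) : Equivariant Γ (G.below h) := by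
  intro γ hγ x p hp
  refine ⟨G.isSAW_map (hΓ hγ) hp.1, ?_⟩
  simpa [List.forall_mem_map, G.tgt_map (hΓ hγ), hh.inv γ hγ] using hp.2

lemma equivariant_aboveLt (hΓ : Γ ≤ G.aut) (hh : IsHeight Γ h) (t : ℝ) :
    Equivariant Γ (G.aboveLt h t) := by
  intro γ hγ x p hp
  refine ⟨G.isSAW_map (hΓ hγ) hp.1, ?_⟩
  simpa [List.forall_mem_map, G.tgt_map (hΓ hγ), hh.inv γ hγ] using hp.2

/-- Every walk can be cut at its last visit to the maximum of a function `f`. -/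
lemma exists_split_max (f : V → ℝ) (x : V) (p : List D) :
    ∃ a b, p = a ++ b ∧ f x ≤ f (G.endpoint x a) ∧ (∀ e ∈ a, f (G.tgt e) ≤ f (G.endpoint x a)) ∧
      ∀ e ∈ b, f (G.tgt e) < f (G.endpoint x a) := by
  induction p generalizing x with
  | nil => exact ⟨[], [], rfl, le_rfl, by simp, by simp⟩
  | cons e p ih =>
    obtain ⟨a, b, rfl, h1, h2, h3⟩ := ih (G.tgt e)
    rcases le_or_gt (f x) (f (G.endpoint (G.tgt e) a)) with hx | hx
    · refine ⟨e :: a, b, rfl, hx, ?_, h3⟩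
      simpa [endpoint] using ⟨h1, h2⟩
    · refine ⟨[], e :: (a ++ b), rfl, le_rfl, by simp, ?_⟩
      simp only [List.mem_cons, List.mem_append, endpoint]
      rintro e' (rfl | he' | he')
      · exact h1.trans_lt hx
      · exact (h2 e' he').trans_lt hx
      · exact (h3 e' he').trans hx

lemma one_le_gf_bridge (hh : IsHeight Γ h) : 1 ≤ G.gf h z lam (G.bridge h) x := by
  have hnil : ([] : List D) ∈ G.bridge h x := ⟨G.isSAW_nil x, by simp⟩
  refine le_trans ?_ (ENNReal.le_tsum (⟨[], hnil⟩ : G.bridge h x))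
  simp [wt, endpoint, hh.self]

lemma append_mem_bridge (hh : IsHeight Γ h) {a b : List D} (ha : a ∈ G.bridge h x)
    (hb : b ∈ G.bridge h (G.endpoint x a)) : a ++ b ∈ G.bridge h x := by
  have hadd := hh.add x (G.endpoint x a)
  have hend : 0 ≤ h x (G.endpoint x a) := by
    rcases List.mem_cons.1 (G.endpoint_mem x a) with h0 | h0
    · rw [h0, hh.self]
    · obtain ⟨e, he, h'⟩ := List.mem_map.1 h0
      rw [← h']
      exact (ha.2 e he).1.le
  have hend' : 0 ≤ h (G.endpoint x a) (G.endpoint (G.endpoint x a) b) := by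
    rcases List.mem_cons.1 (G.endpoint_mem (G.endpoint x a) b) with h0 | h0
    · rw [h0, hh.self]
    · obtain ⟨e, he, h'⟩ := List.mem_map.1 h0
      rw [← h']
      exact (hb.2 e he).1.le
  refine ⟨(G.isSAW_append x a b).2 ⟨ha.1, hb.1, ?_⟩, ?_⟩
  · intro e he hmem
    have h1 := (hb.2 e he).1
    have h2 := hadd (G.tgt e)
    rcases List.mem_cons.1 hmem with h0 | h0
    · rw [h0] at h1 h2
      rw [hh.self] at h2
      linarith
    · obtain ⟨e', he', h'⟩ := List.mem_map.1 h0
      have h3 := (ha.2 e' he').2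
      rw [h'] at h3
      linarith
  · intro e he
    rw [endpoint_append, ← hadd (G.endpoint _ b)]
    rcases List.mem_append.1 he with he | he
    · have := ha.2 e he
      exact ⟨this.1, by linarith⟩
    · have := hb.2 e he
      rw [← hadd (G.tgt e)]
      constructor <;> linarith

/-- Below the critical point, a set `C` of bridges has generating function at most one as soon as
a bridge has at most one decomposition into an element of `C` and a second bridge. Indeed
prepending an element of `C` is then an injection into the set of bridges. -/
lemma gf_le_one_of_prefix_unique (hΓ : Γ ≤ G.aut) (htrans : VertexTransitive Γ)
    (hh : IsHeight Γ h) (hz : 0 ≤ z) {C : V → Set (List D)} (hC : C x ⊆ G.bridge h x)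
    (hinj : ∀ a ∈ C x, ∀ b ∈ G.bridge h (G.endpoint x a), ∀ a' ∈ C x,
      ∀ b' ∈ G.bridge h (G.endpoint x a'), a ++ b = a' ++ b' → a = a')
    (hfin : G.gf h z lam G.saw x ≠ ∞) : G.gf h z lam C x ≤ 1 := by
  have hmul : G.gf h z lam C x * G.gf h z lam (G.bridge h) x ≤ G.gf h z lam (G.bridge h) x :=
    mul_le_gf hΓ htrans hh hz (equivariant_bridge hΓ hh)
      (fun a ha b hb => append_mem_bridge hh (hC ha) hb) hinj
  have h1 : G.gf h z lam (G.bridge h) x ≠ 0 :=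
    (zero_lt_one.trans_le (one_le_gf_bridge hh)).ne'
  have h2 : G.gf h z lam (G.bridge h) x ≠ ∞ :=
    ne_top_of_le_ne_top hfin (gf_mono fun p hp => hp.1)
  have h3 := ENNReal.le_div_iff_mul_le (Or.inl h1) (Or.inl h2) |>.2 hmul
  rwa [ENNReal.div_self h1 h2] at h3

lemma gf_bridge_ofLength_le_one (hΓ : Γ ≤ G.aut) (htrans : VertexTransitive Γ)
    (hh : IsHeight Γ h) (hz : 0 ≤ z) (n : ℕ) (hfin : G.gf h z lam G.saw x ≠ ∞) :
    G.gf h z lam (ofLength (G.bridge h) n) x ≤ 1 :=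
  gf_le_one_of_prefix_unique hΓ htrans hh hz (fun _ hp => hp.1)
    (fun _ ha _ _ _ ha' _ _ heq => (List.append_inj heq (ha.2.trans ha'.2.symm)).1) hfin

/-- A first step that goes up gains at least the least nonzero height difference `δ` along an
edge. -/
lemma le_height_of_first_step {δ : ℝ}
    (hδ : ∀ e, h (G.src e) (G.tgt e) ≠ 0 → δ ≤ |h (G.src e) (G.tgt e)|) {e : D} {p : List D}
    (hp : G.IsPath x (e :: p)) (he : 0 < h x (G.tgt e)) : δ ≤ h x (G.tgt e) := by
  have := hδ e
  rw [hp.1, abs_of_pos he] at this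
  exact this he.ne'

/-- Two decomposition points of a bridge differ in height by at least `δ`. Hence the bridges with
height in an interval of length `δ` have generating function at most one. -/
lemma gf_bridgeIn_le_one (hΓ : Γ ≤ G.aut) (htrans : VertexTransitive Γ)
    (hh : IsHeight Γ h) (hz : 0 ≤ z) {δ : ℝ}
    (hδ : ∀ e, h (G.src e) (G.tgt e) ≠ 0 → δ ≤ |h (G.src e) (G.tgt e)|) {s t : ℝ}
    (hst : t ≤ s + δ) (hfin : G.gf h z lam G.saw x ≠ ∞) :
    G.gf h z lam (G.bridgeIn h s t) x ≤ 1 := by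
  refine gf_le_one_of_prefix_unique hΓ htrans hh hz (fun p hp => hp.1) ?_ hfin
  -- the case in which the first cut is not after the second one
  have key : ∀ a r b' : List D, a ∈ G.bridgeIn h s t x → a ++ r ∈ G.bridgeIn h s t x →
      r ++ b' ∈ G.bridge h (G.endpoint x a) → r = [] := by
    intro a r b' ha ha' hb
    cases r with
    | nil => rfl
    | cons e r =>
      exfalso
      have h1 := (hb.2 e (by simp)).1
      have h2 := le_height_of_first_step hδ hb.1.1 h1
      have h3 := (ha'.1.2 e (by simp)).2
      have h4 := hh.add x (G.endpoint x a) (G.tgt e)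
      have h5 := ha.2.1
      have h6 := ha'.2.2
      linarith
  intro a ha b hb a' ha' b' hb' heq
  rcases List.append_eq_append_iff.1 heq with ⟨r, rfl, rfl⟩ | ⟨r, rfl, rfl⟩
  · simp [key a r b' ha ha' hb]
  · simp [key a' r b ha' ha hb']

/-- Passing from the tilt `lam` to a smaller tilt `lam'` makes bridges exponentially small in
their height. -/
lemma gf_bridgeIn_le_exp (hΓ : Γ ≤ G.aut) (htrans : VertexTransitive Γ)
    (hh : IsHeight Γ h) (hz : 0 ≤ z) {δ : ℝ}
    (hδ : ∀ e, h (G.src e) (G.tgt e) ≠ 0 → δ ≤ |h (G.src e) (G.tgt e)|) {s t lam' : ℝ}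
    (hst : t ≤ s + δ) (hfin : G.gf h z lam G.saw x ≠ ∞) (hlam : lam' ≤ lam) :
    G.gf h z lam' (G.bridgeIn h s t) x ≤ ENNReal.ofReal (Real.exp (-((lam - lam') * s))) := by
  have hle : G.gf h z lam' (G.bridgeIn h s t) x ≤
      ENNReal.ofReal (Real.exp (-((lam - lam') * s))) * G.gf h z lam (G.bridgeIn h s t) x := by
    refine gf_le_gf_of_wt_le fun p hp => ?_
    unfold wt
    rw [← ENNReal.ofReal_mul (by positivity)]
    refine ENNReal.ofReal_le_ofReal ?_
    rw [mul_left_comm, ← Real.exp_add]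
    gcongr
    nlinarith [hp.2.1]
  exact hle.trans (mul_le_of_le_one_right' (gf_bridgeIn_le_one hΓ htrans hh hz hδ hst hfin))

/-! ### The Hammersley–Welsh recursion -/

/-- A half-space walk reaching a height in `[s, t)` is a bridge up to its last highest vertex,
followed by a walk that stays below that vertex in a slab of width less than `t`. -/
lemma gf_aboveLt_le (hΓ : Γ ≤ G.aut) (htrans : VertexTransitive Γ)
    (hh : IsHeight Γ h) (hz : 0 ≤ z) {s t : ℝ} (ht : 0 < t) :
    G.gf h z lam (G.aboveLt h t) x ≤ G.gf h z lam (G.aboveLt h s) x +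
      G.gf h z lam (G.bridgeIn h s t) x * G.gf h z lam (G.aboveLt (-h) t) x := by
  set R : V → Set (List D) := fun x => {p | p ∈ G.aboveLt h t x ∧ p ∉ G.aboveLt h s x}
  have h1 : G.gf h z lam R x ≤
      G.gf h z lam (G.bridgeIn h s t) x * G.gf h z lam (G.aboveLt (-h) t) x := by
    refine gf_le_mul hΓ htrans hh hz (equivariant_aboveLt hΓ hh.neg t) ?_
    rintro p ⟨hp, hps⟩
    obtain ⟨a, b, rfl, hx, ha, hb⟩ := exists_split_max (h x) x p
    have hsaw := (G.isSAW_append x a b).1 hp.1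
    have hlt : h x (G.endpoint x a) < t := by
      rcases List.mem_cons.1 (G.endpoint_mem x a) with h0 | h0
      · rwa [h0, hh.self]
      · obtain ⟨e, he, h'⟩ := List.mem_map.1 h0
        rw [← h']
        exact (hp.2 e (by simp [he])).2
    have hge : s ≤ h x (G.endpoint x a) := by
      by_contra! hlt'
      refine hps ⟨hp.1, fun e he => ⟨(hp.2 e he).1, ?_⟩⟩
      rcases List.mem_append.1 he with he | he
      · exact (ha e he).trans_lt hlt'
      · exact (hb e he).trans hlt'
    refine ⟨a, ⟨⟨hsaw.1, fun e he => ⟨(hp.2 e (by simp [he])).1, ha e he⟩⟩, hge, hlt⟩, b,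
      ⟨hsaw.2.1, fun e he => ?_⟩, rfl⟩
    have h2 := hb e he
    have h3 := (hp.2 e (by simp [he])).1
    have h4 := hh.add x (G.endpoint x a) (G.tgt e)
    simp only [Pi.neg_apply]
    constructor <;> linarith
  refine (gf_le_add (A := G.aboveLt h s) (B := R) ?_).trans (by gcongr)
  intro p hp
  by_cases hps : p ∈ G.aboveLt h s x
  · exact Or.inl hps
  · exact Or.inr ⟨hp, hps⟩

lemma le_two_mul_exp_of_recursion {ρ : ℝ} (hρ0 : 0 ≤ ρ) (hρ1 : ρ < 1) {t : ℕ → ℝ}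
    (ht0 : ∀ n, 0 ≤ t n) (ht1 : t 1 ≤ 2)
    (hrec : ∀ n, t (n + 1) ≤ t n + ρ ^ n * t (n + 1)) (n : ℕ) :
    t (n + 1) ≤ 2 * Real.exp (1 / (1 - ρ) ^ 2) := by
  have h1 : ∀ n, t (n + 1) ≤ 2 * Real.exp (∑ k ∈ Finset.range n, ρ ^ k / (1 - ρ)) := by
    intro n
    induction n with
    | zero => simpa using ht1
    | succ n ih =>
      have hpow : ρ ^ (n + 1) ≤ ρ := by
        simpa using pow_le_pow_of_le_one hρ0 hρ1.le (Nat.succ_le_succ (Nat.zero_le n))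
      have hpow' : ρ ^ (n + 1) ≤ ρ ^ n := pow_le_pow_of_le_one hρ0 hρ1.le (Nat.le_succ n)
      have hpos : 0 < 1 - ρ ^ (n + 1) := by linarith
      have h2 : t (n + 1 + 1) * (1 - ρ ^ (n + 1)) ≤ t (n + 1) := by
        have := hrec (n + 1)
        linarith
      have h3 : 1 ≤ Real.exp (ρ ^ n / (1 - ρ)) * (1 - ρ ^ (n + 1)) := by
        -- `1 / (1 - y) = 1 + y / (1 - y) ≤ exp (y / (1 - y))`
        have h4 : ρ ^ (n + 1) / (1 - ρ ^ (n + 1)) ≤ ρ ^ n / (1 - ρ) := by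
          gcongr
        have h5 := (Real.add_one_le_exp (ρ ^ (n + 1) / (1 - ρ ^ (n + 1)))).trans
          (Real.exp_le_exp.2 h4)
        have h6 : (ρ ^ (n + 1) / (1 - ρ ^ (n + 1)) + 1) * (1 - ρ ^ (n + 1)) = 1 := by
          field_simp
          ring
        exact h6.ge.trans (mul_le_mul_of_nonneg_right h5 hpos.le)
      rw [Finset.sum_range_succ, Real.exp_add, ← mul_assoc]
      calc t (n + 1 + 1)
          ≤ t (n + 1 + 1) * (Real.exp (ρ ^ n / (1 - ρ)) * (1 - ρ ^ (n + 1))) :=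
            le_mul_of_one_le_right (ht0 _) h3
        _ = t (n + 1 + 1) * (1 - ρ ^ (n + 1)) * Real.exp (ρ ^ n / (1 - ρ)) := by ring
        _ ≤ t (n + 1) * Real.exp (ρ ^ n / (1 - ρ)) := by gcongr
        _ ≤ _ := by gcongr
  refine (h1 n).trans ?_
  gcongr
  rw [← Finset.sum_div, sq, ← div_div]
  have : 0 < 1 - ρ := by linarith
  gcongr
  have h7 : ∑ k ∈ Finset.range n, ρ ^ k = (1 - ρ ^ n) / (1 - ρ) := by
    rw [geom_sum_eq hρ1.ne, ← neg_div_neg_eq]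
    simp
  rw [h7]
  gcongr
  linarith [pow_nonneg hρ0 n]

lemma aboveLt_subset_nil {δ : ℝ}
    (hδ : ∀ e, h (G.src e) (G.tgt e) ≠ 0 → δ ≤ |h (G.src e) (G.tgt e)|) :
    G.aboveLt h δ x ⊆ {[]} := by
  intro p hp
  cases p with
  | nil => rfl
  | cons e p =>
    have h1 := hp.2 e (by simp)
    have h2 := le_height_of_first_step hδ hp.1.1 h1.1
    linarith

lemma gf_le_one_of_subset_nil (hh : IsHeight Γ h) {S : V → Set (List D)} (hS : S x ⊆ {[]}) :
    G.gf h z lam S x ≤ 1 := by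
  refine (ENNReal.tsum_mono_subtype _ hS).trans ?_
  simp [wt, endpoint, hh.self]

/-- If bridges, upwards and downwards, are exponentially rare in their height, then the generating
function of half-space walks is bounded by a constant that depends only on the rate. -/
lemma gf_above_le (hΓ : Γ ≤ G.aut) (htrans : VertexTransitive Γ)
    (hh : IsHeight Γ h) (hz : 0 ≤ z) {δ ρ : ℝ} (hδ0 : 0 < δ)
    (hδ : ∀ e, h (G.src e) (G.tgt e) ≠ 0 → δ ≤ |h (G.src e) (G.tgt e)|)
    (hρ0 : 0 ≤ ρ) (hρ1 : ρ < 1) (hfin : G.gf h z lam G.saw x ≠ ∞)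
    (hup : ∀ k : ℕ, G.gf h z lam (G.bridgeIn h (k * δ) ((k + 1 : ℕ) * δ)) x ≤
      ENNReal.ofReal (ρ ^ k))
    (hdown : ∀ k : ℕ, G.gf h z lam (G.bridgeIn (-h) (k * δ) ((k + 1 : ℕ) * δ)) x ≤
      ENNReal.ofReal (ρ ^ k)) :
    G.gf h z lam (G.above h) x ≤ ENNReal.ofReal (2 * Real.exp (1 / (1 - ρ) ^ 2)) := by
  set u : ℕ → ℝ≥0∞ := fun k => G.gf h z lam (G.aboveLt h (k * δ)) x
  set d : ℕ → ℝ≥0∞ := fun k => G.gf h z lam (G.aboveLt (-h) (k * δ)) x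
  have hu : ∀ k, u k ≠ ∞ := fun k => ne_top_of_le_ne_top hfin (gf_mono fun p hp => hp.1)
  have hd : ∀ k, d k ≠ ∞ := fun k => ne_top_of_le_ne_top hfin (gf_mono fun p hp => hp.1)
  have hurec : ∀ k, u (k + 1) ≤ u k + ENNReal.ofReal (ρ ^ k) * d (k + 1) := fun k =>
    (gf_aboveLt_le hΓ htrans hh hz (s := k * δ) (by positivity)).trans
      (by gcongr; exact hup k)
  have hdrec : ∀ k, d (k + 1) ≤ d k + ENNReal.ofReal (ρ ^ k) * u (k + 1) := fun k => by
    have := gf_aboveLt_le (G := G) (x := x) (lam := -lam) hΓ htrans hh.neg hz (s := k * δ)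
      (t := (k + 1 : ℕ) * δ) (by positivity)
    simp only [gf_neg, neg_neg] at this
    exact this.trans (by gcongr; exact hdown k)
  have hδ' : ∀ e, (-h) (G.src e) (G.tgt e) ≠ 0 → δ ≤ |(-h) (G.src e) (G.tgt e)| := by
    simpa using hδ
  -- a half-space walk below height `δ` is empty, so the recursion starts from `u 1 + d 1 ≤ 2`
  have hbound := le_two_mul_exp_of_recursion hρ0 hρ1 (t := fun k => (u k + d k).toReal)
    (fun k => ENNReal.toReal_nonneg) (by
      refine ENNReal.toReal_le_of_le_ofReal (by norm_num) ?_
      have h1 : u 1 ≤ 1 := by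
        simp only [u, Nat.cast_one, one_mul]
        exact gf_le_one_of_subset_nil hh (aboveLt_subset_nil hδ)
      have h2 : d 1 ≤ 1 := by
        simp only [d, Nat.cast_one, one_mul]
        exact gf_le_one_of_subset_nil hh (aboveLt_subset_nil hδ')
      refine (add_le_add h1 h2).trans (le_of_eq ?_)
      rw [one_add_one_eq_two]
      simp)
    (fun k => by
      have h1 : u (k + 1) + d (k + 1) ≤
          u k + d k + ENNReal.ofReal (ρ ^ k) * (u (k + 1) + d (k + 1)) := by
        refine (add_le_add (hurec k) (hdrec k)).trans (le_of_eq ?_)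
        ring
      have h2 := ENNReal.toReal_mono (by simp [hu, hd, ENNReal.mul_eq_top]) h1
      rwa [ENNReal.toReal_add (a := u k + d k) (by simp [hu, hd])
        (by simp [hu, hd, ENNReal.mul_eq_top]),
        ENNReal.toReal_mul, ENNReal.toReal_ofReal (by positivity)] at h2)
  have hu' : ∀ k, u (k + 1) ≤ ENNReal.ofReal (2 * Real.exp (1 / (1 - ρ) ^ 2)) := fun k => by
    refine le_trans ?_ (ENNReal.ofReal_le_ofReal (hbound k))
    rw [ENNReal.ofReal_toReal (by simp [hu, hd])]
    exact le_self_add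
  -- a finite set of half-space walks lies in a slab
  have hslab : ∀ s : Finset (G.above h x), ∃ k : ℕ, ∀ p ∈ s, p.1 ∈ G.aboveLt h ((k + 1 : ℕ) * δ) x := by
    have hone : ∀ l : List D, ∃ K : ℝ, ∀ e ∈ l, h x (G.tgt e) ≤ K := by
      intro l
      induction l with
      | nil => exact ⟨0, by simp⟩
      | cons e l ih =>
        obtain ⟨K, hK⟩ := ih
        refine ⟨max K (h x (G.tgt e)), ?_⟩
        simp only [List.mem_cons, forall_eq_or_imp]
        exact ⟨le_max_right _ _, fun e' he' => (hK e' he').trans (le_max_left _ _)⟩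
    choose K hK using hone
    intro s
    obtain ⟨M, hM⟩ := (s.image fun p => K p.1).bddAbove
    obtain ⟨k, hk⟩ := exists_nat_gt (M / δ)
    refine ⟨k, fun p hp => ⟨p.2.1, fun e he => ⟨p.2.2 e he, ?_⟩⟩⟩
    have h1 := hK p.1 e he
    have h2 : K p.1 ≤ M := hM (by simpa using ⟨p.1, ⟨p.2, hp⟩, rfl⟩)
    have h3 := (div_lt_iff₀ hδ0).1 hk
    push_cast
    linarith
  unfold gf
  rw [ENNReal.tsum_eq_iSup_sum]
  refine iSup_le fun s => ?_
  obtain ⟨k, hk⟩ := hslab s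
  refine le_trans ?_ (hu' k)
  have h1 : ∑ p ∈ s, G.wt h z lam x p =
      ∑' p : s, G.wt h z lam x ((⟨p.1.1, hk p.1 p.2⟩ : G.aboveLt h ((k + 1 : ℕ) * δ) x) : List D) := by
    rw [tsum_fintype, Finset.univ_eq_attach]
    exact (Finset.sum_attach s (fun p => G.wt h z lam x p)).symm
  rw [h1]
  refine ENNReal.tsum_comp_le_tsum_of_injective
    (f := fun p : s => (⟨p.1.1, hk p.1 p.2⟩ : G.aboveLt h ((k + 1 : ℕ) * δ) x)) ?_ _
  intro p q hpq
  have hval : p.1.1 = q.1.1 := Subtype.mk.inj hpq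
  exact Subtype.ext (Subtype.ext hval)

/-! ### Decomposing walks at their extrema -/

lemma gf_saw_le_mul (hΓ : Γ ≤ G.aut) (htrans : VertexTransitive Γ)
    (hh : IsHeight Γ h) (hz : 0 ≤ z) :
    G.gf h z lam G.saw x ≤ G.gf h z lam (G.toMax h) x * G.gf h z lam (G.below h) x := by
  refine gf_le_mul hΓ htrans hh hz (equivariant_below hΓ hh) fun p hp => ?_
  obtain ⟨a, b, rfl, hx, ha, hb⟩ := exists_split_max (h x) x p
  have hsaw := (G.isSAW_append x a b).1 hp
  rw [hh.self] at hx
  refine ⟨a, ⟨hsaw.1, hx, ha⟩, b, ⟨hsaw.2.1, fun e he => ?_⟩, rfl⟩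
  have h1 := hb e he
  have h2 := hh.add x (G.endpoint x a) (G.tgt e)
  linarith

/-- Prepending a downward step turns walks in a closed half-space into walks in an open one. -/
lemma wt_mul_gf_below_le (hΓ : Γ ≤ G.aut) (htrans : VertexTransitive Γ)
    (hh : IsHeight Γ h) (hz : 0 ≤ z) {e : D} (hx : G.src e = x) (he : h x (G.tgt e) < 0) :
    G.wt h z lam x [e] * G.gf h z lam (G.below h) x ≤ G.gf h z lam (G.above (-h)) x := by
  have hsingle : G.gf h z lam (fun _ => {[e]}) x = G.wt h z lam x [e] := by
    simp [gf]
  rw [← hsingle]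
  refine mul_le_gf hΓ htrans hh hz (equivariant_below hΓ hh) ?_ ?_
  · rintro a rfl b ⟨hb, hb'⟩
    have hlt : ∀ e' ∈ b, h x (G.tgt e') < 0 := fun e' he' => by
      have h1 := hb' e' he'
      have h2 := hh.add x (G.tgt e) (G.tgt e')
      simp only [endpoint] at h1
      linarith
    refine ⟨(G.isSAW_append x [e] b).2 ⟨⟨⟨hx, trivial⟩, ?_⟩, hb, ?_⟩, ?_⟩
    · have hne : x ≠ G.tgt e := by
        intro h0
        rw [← h0, hh.self] at he
        exact lt_irrefl _ he
      simpa using hne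
    · intro e' he' hmem
      simp only [List.map_cons, List.map_nil, List.mem_cons, List.not_mem_nil, or_false] at hmem
      rcases hmem with h0 | h0
      · have := hlt e' he'
        rw [h0, hh.self] at this
        exact lt_irrefl _ this
      · have h1 := (List.nodup_cons.1 hb.2).1
        refine h1 ?_
        simp only [endpoint]
        rw [← h0]
        exact List.mem_map_of_mem he'
    · simp only [Pi.neg_apply, Left.neg_pos_iff, List.mem_append, List.mem_singleton]
      rintro e' (rfl | he')
      · exact he
      · exact hlt e' he'
  · rintro a rfl b _ a' rfl b' _ _
    rfl

lemma gf_descent_le {lam' : ℝ} (hz : 0 ≤ z) (hlam : lam' ≤ lam) :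
    G.gf h z lam (G.descent h) x ≤ G.gf h z lam' G.saw x := by
  have h1 : G.gf h z lam (G.descent h) x ≤ 1 * G.gf h z lam' (G.descent h) x := by
    refine gf_le_gf_of_wt_le fun p hp => ?_
    rw [one_mul]
    refine ENNReal.ofReal_le_ofReal ?_
    gcongr ?_ * Real.exp ?_
    nlinarith [hp.2]
  rw [one_mul] at h1
  exact h1.trans (gf_mono fun p hp => hp.1)

/-- A self-avoiding walk is a bridge between its extrema, with a walk that descends attached at
both ends. At the tilt `lam` the descents cost no more than at the smaller tilt `lam'`. -/
lemma gf_saw_ofLength_le (hΓ : Γ ≤ G.aut) (htrans : VertexTransitive Γ)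
    (hh : IsHeight Γ h) (hz : 0 ≤ z) {lam' : ℝ} (hlam : lam' ≤ lam) {M : ℝ≥0∞}
    (hM : ∀ n, G.gf h z lam (ofLength (G.bridge h) n) x ≤ M) (n : ℕ) :
    G.gf h z lam (ofLength G.saw n) x ≤ M * G.gf h z lam' G.saw x ^ 2 := by
  set χ := G.gf h z lam' G.saw x
  have hmax : ∀ m, G.gf h z lam (ofLength (G.toMax h) m) x ≤ M * χ := by
    intro m
    refine (gf_le_tsum_of_split hh hz (A := G.descent h)
      (B := fun a => ofLength (G.bridge h) (m - a.length)) (fun _ => M) ?_ fun a _ => ?_).trans ?_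
    · rintro p ⟨⟨hp, hp0, hmax⟩, rfl⟩
      obtain ⟨a, b, rfl, hx, ha, hb⟩ := exists_split_max (fun v => -h x v) x p
      have hsaw := (G.isSAW_append x a b).1 hp
      rw [hh.self] at hx
      refine ⟨a, ⟨hsaw.1, by linarith⟩, b, ⟨⟨hsaw.2.1, fun e he => ?_⟩, by simp⟩, rfl⟩
      have h1 := hb e he
      have h2 := hmax e (by simp [he])
      rw [endpoint_append] at h2
      have h3 := hh.add x (G.endpoint x a) (G.tgt e)
      have h4 := hh.add x (G.endpoint x a) (G.endpoint (G.endpoint x a) b)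
      constructor <;> linarith
    · rw [gf_eq_gf hΓ htrans hh ((equivariant_bridge hΓ hh).ofLength _) _ x]
      exact hM _
    · rw [ENNReal.tsum_mul_right, mul_comm]
      gcongr
      exact gf_descent_le hz hlam
  set g : ℕ → ℝ≥0∞ := fun m => G.gf h z lam (ofLength (G.descent h) m) x
  set A : V → Set (List D) := fun x => {p | p ∈ G.toMax h x ∧ p.length ≤ n}
  refine (gf_le_tsum_of_split hh hz (A := A)
    (B := fun a => ofLength (G.descent h) (n - a.length)) (fun a => g (n - a.length)) ?_
    fun a _ => (gf_eq_gf hΓ htrans hh ((equivariant_descent hΓ hh).ofLength _) _ x).le).trans ?_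
  · rintro p ⟨hp, rfl⟩
    obtain ⟨a, b, rfl, hx, ha, hb⟩ := exists_split_max (h x) x p
    have hsaw := (G.isSAW_append x a b).1 hp
    rw [hh.self] at hx
    refine ⟨a, ⟨⟨hsaw.1, hx, ha⟩, by simp⟩, b, ⟨⟨hsaw.2.1, ?_⟩, by simp⟩, rfl⟩
    rcases List.mem_cons.1 (G.endpoint_mem (G.endpoint x a) b) with h0 | h0
    · rw [h0, hh.self]
    · obtain ⟨e, he, h'⟩ := List.mem_map.1 h0
      have h1 := hb e he
      have h2 := hh.add x (G.endpoint x a) (G.tgt e)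
      rw [h'] at h1 h2
      linarith
  · refine (tsum_ofLength A x fun a => G.wt h z lam x a * g (n - a.length)).ge.trans ?_
    have hterm : ∀ m, ∑' a : ofLength A m x,
        G.wt h z lam x a * g (n - a.1.length) ≤ if m ∈ Finset.range (n + 1) then
          M * χ * g (n - m) else 0 := by
      intro m
      split_ifs with hm
      · calc _ = ∑' a : ofLength A m x,
                G.wt h z lam x a * g (n - m) := tsum_congr fun a => by rw [a.2.2]
          _ ≤ _ := by
            rw [ENNReal.tsum_mul_right]
            gcongr
            exact (gf_mono (T := ofLength (G.toMax h) m) fun _ hp => ⟨hp.1.1, hp.2⟩).trans (hmax m)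
      · rw [nonpos_iff_eq_zero, ENNReal.tsum_eq_zero]
        rintro ⟨a, ⟨-, h1⟩, h2⟩
        simp only [Finset.mem_range] at hm
        omega
    calc _ ≤ ∑' m, if m ∈ Finset.range (n + 1) then M * χ * g (n - m) else 0 :=
          ENNReal.tsum_le_tsum hterm
      _ = ∑ m ∈ Finset.range (n + 1), M * χ * g (n - m) := by
          rw [tsum_eq_sum (s := Finset.range (n + 1)) (fun m hm => if_neg hm)]
          exact Finset.sum_congr rfl fun m hm => if_pos hm
      _ = M * χ * ∑ m ∈ Finset.range (n + 1), g m := by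
          rw [← Finset.mul_sum, Finset.sum_flip]
      _ ≤ M * χ * χ := by
          gcongr
          calc _ ≤ ∑' m, g m := ENNReal.sum_le_tsum _
            _ = G.gf h z lam (G.descent h) x := gf_eq_tsum_ofLength.symm
            _ ≤ χ := gf_descent_le hz hlam
      _ = _ := by ring

end MGraph

section Modular

variable {V D : Type*} (Γ : Subgroup (Equiv.Perm V × Equiv.Perm D))

/-! ### The modular function and the mass-transport principle -/

/-- The stabilizer of `x` in `Γ`. -/
def vertexStab (x : V) : Subgroup (Equiv.Perm V × Equiv.Perm D) where
  carrier := {γ | γ ∈ Γ ∧ γ.1 x = x}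
  mul_mem' := by
    rintro a b ⟨ha, ha'⟩ ⟨hb, hb'⟩
    exact ⟨Γ.mul_mem ha hb, by simp [ha', hb']⟩
  one_mem' := ⟨Γ.one_mem, rfl⟩
  inv_mem' := by
    rintro a ⟨ha, ha'⟩
    exact ⟨Γ.inv_mem ha, a.1.symm_apply_eq.2 ha'.symm⟩

lemma ncard_stabOrbit (x y : V) :
    (stabOrbit Γ x y).ncard = (vertexStab Γ y).relIndex (vertexStab Γ x) := by
  let _ : MulAction (Equiv.Perm V × Equiv.Perm D) V :=
    MulAction.compHom V (MonoidHom.fst (Equiv.Perm V) (Equiv.Perm D))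
  have hsmul : ∀ (γ : Equiv.Perm V × Equiv.Perm D) (v : V), γ • v = γ.1 v := fun _ _ => rfl
  have h1 : stabOrbit Γ x y = MulAction.orbit (vertexStab Γ x) y := by
    ext v
    constructor
    · rintro ⟨γ, hγ, hx, hv⟩
      exact ⟨⟨γ, hγ, hx⟩, hv⟩
    · rintro ⟨⟨γ, hγ, hx⟩, hv⟩
      exact ⟨γ, hγ, hx, hv⟩
  have h2 : MulAction.stabilizer (vertexStab Γ x) y =
      (vertexStab Γ y).subgroupOf (vertexStab Γ x) := by
    ext ⟨γ, hγ⟩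
    rw [MulAction.mem_stabilizer_iff, Subgroup.mem_subgroupOf]
    exact ⟨fun h => ⟨hγ.1, h⟩, fun h => h.2⟩
  rw [h1, ← MulAction.index_stabilizer, h2, Subgroup.relIndex]

lemma stabOrbit_map {γ : Equiv.Perm V × Equiv.Perm D} (hγ : γ ∈ Γ) (x y : V) :
    stabOrbit Γ (γ.1 x) (γ.1 y) = γ.1 '' stabOrbit Γ x y := by
  ext v
  constructor
  · rintro ⟨σ, hσ, hx, rfl⟩
    refine ⟨(γ⁻¹ * σ * γ).1 y, ⟨γ⁻¹ * σ * γ, Γ.mul_mem (Γ.mul_mem (Γ.inv_mem hγ) hσ) hγ, ?_, rfl⟩,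
      ?_⟩
    · simp [hx]
    · simp
  · rintro ⟨w, ⟨σ, hσ, hx, rfl⟩, rfl⟩
    exact ⟨γ * σ * γ⁻¹, Γ.mul_mem (Γ.mul_mem hγ hσ) (Γ.inv_mem hγ), by simp [hx], by simp⟩

lemma modular_map {γ : Equiv.Perm V × Equiv.Perm D} (hγ : γ ∈ Γ) (x y : V) :
    modular Γ (γ.1 x) (γ.1 y) = modular Γ x y := by
  simp only [modular, stabOrbit_map Γ hγ, Set.ncard_image_of_injective _ γ.1.injective]

variable {Γ}

lemma ncard_stabOrbit_pos (hfin : ∀ x y, (stabOrbit Γ x y).Finite) (x y : V) :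
    0 < (stabOrbit Γ x y).ncard :=
  (Set.ncard_pos (hfin x y)).2 ⟨y, 1, Γ.one_mem, rfl, rfl⟩

lemma modular_pos (hfin : ∀ x y, (stabOrbit Γ x y).Finite) (x y : V) : 0 < modular Γ x y := by
  have h1 := ncard_stabOrbit_pos hfin x y
  have h2 := ncard_stabOrbit_pos hfin y x
  unfold modular
  positivity

/-- The cocycle identity follows from the multiplicativity of indices along the chains
`A ⊓ B ⊓ C ≤ A ⊓ B ≤ A` of stabilizers. -/
lemma modular_mul (hfin : ∀ x y, (stabOrbit Γ x y).Finite) (x y w : V) :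
    modular Γ x y * modular Γ y w = modular Γ x w := by
  have hpos : ∀ x y, (vertexStab Γ y).relIndex (vertexStab Γ x) ≠ 0 := fun x y => by
    rw [← ncard_stabOrbit]
    exact (ncard_stabOrbit_pos hfin x y).ne'
  have key : ∀ A B C : Subgroup (Equiv.Perm V × Equiv.Perm D),
      (C.relIndex (A ⊓ B) : ℝ) * B.relIndex A = B.relIndex (A ⊓ C) * C.relIndex A := by
    intro A B C
    have h1 := Subgroup.relIndex_inf_mul_relIndex C B A
    have h2 := Subgroup.relIndex_inf_mul_relIndex B C A
    rw [inf_comm B A] at h1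
    rw [inf_comm C A, inf_comm B C] at h2
    exact_mod_cast h1.trans h2.symm
  have hcast : ∀ n : ℕ, n ≠ 0 → (n : ℝ) ≠ 0 := fun n hn => Nat.cast_ne_zero.2 hn
  have hBA := hcast _ (hpos x y)
  have hCB := hcast _ (hpos y w)
  have hCA := hcast _ (hpos x w)
  have ha := hcast _ fun h => hpos x w
    (Subgroup.relIndex_eq_zero_of_le_right (inf_le_left (b := vertexStab Γ y)) h)
  have hc := hcast _ fun h => hpos x y
    (Subgroup.relIndex_eq_zero_of_le_right (inf_le_left (b := vertexStab Γ w)) h)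
  have h2 := key (vertexStab Γ y) (vertexStab Γ x) (vertexStab Γ w)
  have h3 := key (vertexStab Γ w) (vertexStab Γ x) (vertexStab Γ y)
  have h1 := key (vertexStab Γ x) (vertexStab Γ y) (vertexStab Γ w)
  rw [inf_comm (vertexStab Γ y) (vertexStab Γ x)] at h2
  rw [inf_comm (vertexStab Γ w) (vertexStab Γ x), inf_comm (vertexStab Γ w) (vertexStab Γ y)] at h3
  simp only [modular, ncard_stabOrbit]
  generalize ((vertexStab Γ w).relIndex (vertexStab Γ x ⊓ vertexStab Γ y) : ℝ) = a at *
  generalize ((vertexStab Γ y).relIndex (vertexStab Γ x ⊓ vertexStab Γ w) : ℝ) = c at *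
  rw [div_mul_div_comm, div_eq_div_iff (mul_ne_zero hBA hCB) hCA]
  refine mul_left_cancel₀ (mul_ne_zero ha hc) ?_
  linear_combination (c * ((vertexStab Γ y).relIndex (vertexStab Γ w) : ℝ) *
      ((vertexStab Γ w).relIndex (vertexStab Γ x) : ℝ)) * h2
    - (((vertexStab Γ w).relIndex (vertexStab Γ y) : ℝ) * c *
      ((vertexStab Γ w).relIndex (vertexStab Γ x) : ℝ)) * h3
    - (((vertexStab Γ w).relIndex (vertexStab Γ y) : ℝ) * c *
      ((vertexStab Γ x).relIndex (vertexStab Γ w) : ℝ)) * h1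

/-- The mass-transport principle. -/
lemma mass_transport (htrans : VertexTransitive Γ) (hfin : ∀ x y, (stabOrbit Γ x y).Finite)
    (F : V → V → ℝ≥0∞) (hF : ∀ γ ∈ Γ, ∀ x y, F (γ.1 x) (γ.1 y) = F x y) (o : V) :
    ∑' y, F o y = ∑' y, F y o * ENNReal.ofReal (modular Γ o y) := by
  classical
  -- `(o, y)` and `(y', o)` lie in the same orbit of pairs
  let R : V → V → Prop := fun y y' => ∃ γ ∈ Γ, γ.1 y' = o ∧ γ.1 o = y
  have hsymm : ∀ y y', R y y' → R y' y := by
    rintro y y' ⟨γ, hγ, h1, h2⟩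
    exact ⟨γ⁻¹, Γ.inv_mem hγ, by simp [← h2], by simp [← h1]⟩
  have hRF : ∀ y y', R y y' → F o y = F y' o := by
    rintro y y' ⟨γ, hγ, rfl, h2⟩
    rw [← h2, hF γ hγ]
  have hcard1 : ∀ y, {y' | R y y'}.Finite ∧ {y' | R y y'}.ncard = (stabOrbit Γ y o).ncard := by
    intro y
    obtain ⟨γ, hγ, rfl⟩ := htrans o y
    have : {y' | R (γ.1 o) y'} = γ⁻¹.1 '' stabOrbit Γ (γ.1 o) o := by
      ext y'
      constructor
      · rintro ⟨σ, hσ, h1, h2⟩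
        refine ⟨γ.1 y', ⟨γ * σ⁻¹, Γ.mul_mem hγ (Γ.inv_mem hσ), ?_, ?_⟩, by simp⟩
        · simp [← h2]
        · simp [← h1]
      · rintro ⟨_, ⟨σ, hσ, h1, rfl⟩, rfl⟩
        refine ⟨σ⁻¹ * γ, Γ.mul_mem (Γ.inv_mem hσ) hγ, by simp, ?_⟩
        exact σ.1.symm_apply_eq.2 h1.symm
    rw [this]
    exact ⟨(hfin _ _).image _, Set.ncard_image_of_injective _ (γ⁻¹.1.injective)⟩
  have hcard2 : ∀ y y', R y y' → (stabOrbit Γ y o).ncard = (stabOrbit Γ o y').ncard := by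
    intro y y' hR
    rw [← (hcard1 y).2]
    congr 1
    obtain ⟨γ, hγ, h1, h2⟩ := hR
    ext v
    constructor
    · rintro ⟨σ, hσ, h3, h4⟩
      refine ⟨σ⁻¹ * γ, Γ.mul_mem (Γ.inv_mem hσ) hγ, ?_, ?_⟩
      · simp [h2, ← h4]
      · simp [h1, ← h3]
    · rintro ⟨σ, hσ, h3, rfl⟩
      refine ⟨γ * σ⁻¹, Γ.mul_mem hγ (Γ.inv_mem hσ), by simp [h1], ?_⟩
      have : σ.1.symm o = o := σ.1.symm_apply_eq.2 h3.symm
      simp [this, h2]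
  have hsum : ∀ y (c : ℝ≥0∞), ∑' y', (if R y y' then c else 0) = (stabOrbit Γ y o).ncard * c := by
    intro y c
    have h1 : ∑' y', (if R y y' then c else 0) = ∑' _ : {y' | R y y'}, c :=
      (tsum_subtype {y' | R y y'} fun _ => c).symm
    rw [h1, ENNReal.tsum_set_const, ← (hcard1 y).2, ← (hcard1 y).1.cast_ncard_eq]
    simp
  have hn : ∀ x y, ((stabOrbit Γ x y).ncard : ℝ≥0∞) ≠ 0 := fun x y => by
    exact_mod_cast (ncard_stabOrbit_pos hfin x y).ne'
  calc ∑' y, F o y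
      = ∑' y, ∑' y', if R y y' then F o y / (stabOrbit Γ y o).ncard else 0 := by
        refine tsum_congr fun y => ?_
        rw [hsum, ENNReal.mul_div_cancel (hn _ _) (ENNReal.natCast_ne_top _)]
    _ = ∑' y', ∑' y, if R y' y then F y' o / (stabOrbit Γ o y').ncard else 0 := by
        rw [ENNReal.tsum_comm]
        refine tsum_congr fun y' => tsum_congr fun y => ?_
        by_cases hR : R y y'
        · rw [if_pos hR, if_pos (hsymm _ _ hR), hRF _ _ hR, hcard2 _ _ hR]
        · rw [if_neg hR, if_neg fun h => hR (hsymm _ _ h)]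
    _ = ∑' y, F y o * ENNReal.ofReal (modular Γ o y) := by
        refine tsum_congr fun y => ?_
        rw [hsum, modular, ENNReal.ofReal_div_of_pos
          (by exact_mod_cast ncard_stabOrbit_pos hfin o y), ENNReal.ofReal_natCast,
          ENNReal.ofReal_natCast]
        simp only [div_eq_mul_inv]
        ring

end Modular

namespace MGraph

variable {V D : Type*} {G : MGraph V D} {Γ : Subgroup (Equiv.Perm V × Equiv.Perm D)}

lemma finite_paths (hloc : G.LocallyFinite) (x : V) (n : ℕ) :
    {p | G.IsPath x p ∧ p.length = n}.Finite := by
  induction n generalizing x with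
  | zero => exact (Set.finite_singleton []).subset fun p hp => List.length_eq_zero_iff.1 hp.2
  | succ n ih =>
    refine ((hloc x).biUnion fun e _ => (ih (G.tgt e)).image (List.cons e)).subset ?_
    rintro p ⟨hp, hlen⟩
    cases p with
    | nil => simp at hlen
    | cons e p => exact Set.mem_biUnion hp.1 ⟨p, ⟨hp.2, by simpa using hlen⟩, rfl⟩

lemma finite_stabOrbit (hconn : G.Connected) (hloc : G.LocallyFinite) (hΓ : Γ ≤ G.aut) (x y : V) :
    (stabOrbit Γ x y).Finite := by
  obtain ⟨p, hp, rfl⟩ := hconn x y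
  refine ((finite_paths hloc x p.length).image (G.endpoint x)).subset ?_
  rintro v ⟨γ, hγ, hx, rfl⟩
  refine ⟨p.map γ.2, ⟨?_, by simp⟩, ?_⟩
  · have := G.isPath_map (hΓ hγ) hp
    rwa [hx] at this
  · rw [← G.endpoint_map (hΓ hγ), hx]

/-- The height difference `log Δ(x, y)`. -/
noncomputable def logModular (Γ : Subgroup (Equiv.Perm V × Equiv.Perm D)) (x y : V) : ℝ :=
  Real.log (modular Γ x y)

lemma isHeight_logModular (hfin : ∀ x y, (stabOrbit Γ x y).Finite) :
    IsHeight Γ (logModular Γ) where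
  add x y w := by
    rw [logModular, logModular, logModular, ← modular_mul hfin x y w,
      Real.log_mul (modular_pos hfin _ _).ne' (modular_pos hfin _ _).ne']
  inv γ hγ x y := by rw [logModular, logModular, modular_map Γ hγ]

/-- Reversing walks exchanges the tilts `lam` and `1 - lam`, by the mass-transport principle. -/
lemma gf_le_gf_of_revPath (hΓ : Γ ≤ G.aut) (htrans : VertexTransitive Γ)
    (hfin : ∀ x y, (stabOrbit Γ x y).Finite) {z lam lam' : ℝ} (hz : 0 ≤ z) (hlam : lam + lam' = 1)
    {S T : V → Set (List D)} (hS : Equivariant Γ S)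
    (hST : ∀ y, ∀ p ∈ S y, G.IsPath y p ∧ G.revPath p ∈ T (G.endpoint y p)) (o : V) :
    G.gf (logModular Γ) z lam S o ≤ G.gf (logModular Γ) z lam' T o := by
  classical
  have hh := isHeight_logModular hfin
  let F : V → V → ℝ≥0∞ := fun x y =>
    ∑' p : S x, if G.endpoint x p = y then G.wt (logModular Γ) z lam x p else 0
  have hF : ∀ γ ∈ Γ, ∀ x y, F (γ.1 x) (γ.1 y) = F x y := by
    intro γ hγ x y
    let e : S x ≃ S (γ.1 x) :=
      { toFun := fun p => ⟨p.1.map γ.2, hS γ hγ x p p.2⟩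
        invFun := fun p => ⟨p.1.map γ⁻¹.2, by
          simpa using hS γ⁻¹ (Γ.inv_mem hγ) (γ.1 x) p p.2⟩
        left_inv := fun p => by simp [Function.comp_def]
        right_inv := fun p => by simp [Function.comp_def] }
    have h1 := e.tsum_eq fun p : S (γ.1 x) =>
      if G.endpoint (γ.1 x) p = γ.1 y then G.wt (logModular Γ) z lam (γ.1 x) p else 0
    refine h1.symm.trans (tsum_congr fun p => ?_)
    simp only [e, Equiv.coe_fn_mk, G.endpoint_map (hΓ hγ), wt_map hΓ hh hγ,
      γ.1.injective.eq_iff]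
  have h1 : G.gf (logModular Γ) z lam S o = ∑' y, F o y := by
    simp only [F]
    rw [ENNReal.tsum_comm]
    refine tsum_congr fun p => ?_
    rw [tsum_ite_eq']
  rw [h1, mass_transport htrans hfin F hF]
  have h2 : ∀ y (p : S y), (if G.endpoint y p = o then G.wt (logModular Γ) z lam y p else 0) *
      ENNReal.ofReal (modular Γ o y) =
      if G.endpoint y p = o then G.wt (logModular Γ) z lam' o (G.revPath p) else 0 := by
    intro y p
    split_ifs with hp
    · subst hp
      have hpath := (hST y p p.2).1
      unfold wt
      rw [← ENNReal.ofReal_mul (by positivity), G.endpoint_revPath hpath, length_revPath,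
        hh.swap (G.endpoint y p) y,
        ← Real.exp_log (modular_pos hfin (G.endpoint y p) y), mul_assoc, ← Real.exp_add]
      congr 3
      change lam * -logModular Γ (G.endpoint y p) y + logModular Γ (G.endpoint y p) y = _
      rw [← eq_sub_iff_add_eq'] at hlam
      rw [hlam]
      ring
    · simp
  let Q : Set (Σ y, S y) := {s | G.endpoint s.1 s.2 = o}
  calc ∑' y, F y o * ENNReal.ofReal (modular Γ o y)
      = ∑' y, ∑' p : S y,
          if G.endpoint y p = o then G.wt (logModular Γ) z lam' o (G.revPath p) else 0 := by
        refine tsum_congr fun y => ?_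
        simp only [F]
        rw [← ENNReal.tsum_mul_right]
        exact tsum_congr fun p => h2 y p
    _ = ∑' s : Q, G.wt (logModular Γ) z lam' o (G.revPath s.1.2) := by
        rw [tsum_subtype Q fun s => G.wt (logModular Γ) z lam' o (G.revPath s.2),
          ENNReal.tsum_sigma']
        rfl
    _ ≤ _ := by
        have hT : ∀ s : Q, G.revPath s.1.2 ∈ T o := fun s => by
          have h3 := (hST s.1.1 s.1.2 s.1.2.2).2
          rwa [s.2] at h3
        refine ENNReal.tsum_comp_le_tsum_of_injective
          (f := fun s : Q => (⟨G.revPath s.1.2, hT s⟩ : T o)) ?_ _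
        rintro ⟨⟨y, p, hp⟩, hs⟩ ⟨⟨y', p', hp'⟩, hs'⟩ heq
        have h3 : G.revPath p = G.revPath p' := Subtype.mk.inj heq
        have h4 : p = p' := by
          rw [← G.revPath_revPath p, h3, G.revPath_revPath]
        subst h4
        have h5 := G.endpoint_revPath (hST y p hp).1
        have h6 := G.endpoint_revPath (hST y' p hp').1
        have hs : G.endpoint y p = o := hs
        have hs' : G.endpoint y' p = o := hs'
        rw [hs] at h5
        rw [hs'] at h6
        obtain rfl := h5.symm.trans h6
        rfl

end MGraph

namespace MGraph

variable {V D : Type*} {G : MGraph V D} {Γ : Subgroup (Equiv.Perm V × Equiv.Perm D)}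

/-! ### Height differences along edges -/

/-- By transitivity and local finiteness, the height difference along an edge takes finitely many
values; so it is bounded, and bounded away from zero where it is nonzero. -/
lemma exists_edge_bounds (hloc : G.LocallyFinite) (hΓ : Γ ≤ G.aut) (htrans : VertexTransitive Γ)
    {h : V → V → ℝ} (hh : IsHeight Γ h) (o : V) :
    ∃ δ > 0, ∃ L > 0, ∀ e, |h (G.src e) (G.tgt e)| ≤ L ∧
      (h (G.src e) (G.tgt e) ≠ 0 → δ ≤ |h (G.src e) (G.tgt e)|) := by
  classical
  set s : Finset ℝ := (hloc o).toFinset.image fun e => |h o (G.tgt e)|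
  have hs : ∀ e, |h (G.src e) (G.tgt e)| ∈ s := by
    intro e
    obtain ⟨γ, hγ, ho⟩ := htrans (G.src e) o
    refine Finset.mem_image.2 ⟨γ.2 e, ?_, ?_⟩
    · simp [((hΓ hγ) e).1, ho]
    · rw [G.tgt_map (hΓ hγ), ← ho, hh.inv γ hγ]
  obtain ⟨L, hL⟩ := s.bddAbove
  have hδ : ∃ δ > 0, ∀ v ∈ s, v ≠ 0 → δ ≤ v := by
    have hpos : ∀ v ∈ s, 0 ≤ v := by
      intro v hv
      obtain ⟨e, -, rfl⟩ := Finset.mem_image.1 hv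
      exact abs_nonneg _
    rcases (s.filter (· ≠ 0)).eq_empty_or_nonempty with h0 | h0
    · refine ⟨1, one_pos, fun v hv hv0 => ?_⟩
      have : v ∈ s.filter (· ≠ 0) := Finset.mem_filter.2 ⟨hv, hv0⟩
      simp [h0] at this
    · obtain ⟨δ, hδ, hmin⟩ := Finset.exists_min_image _ id h0
      have hδ' := Finset.mem_filter.1 hδ
      exact ⟨δ, lt_of_le_of_ne (hpos δ hδ'.1) (Ne.symm hδ'.2),
        fun v hv hv0 => hmin v (Finset.mem_filter.2 ⟨hv, hv0⟩)⟩
  obtain ⟨δ, hδ0, hδ⟩ := hδ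
  refine ⟨δ, hδ0, max L 1, by positivity, fun e => ⟨(hL (hs e)).trans (le_max_left _ _), ?_⟩⟩
  exact fun h0 => hδ _ (hs e) (abs_ne_zero.2 h0)

lemma abs_height_le {h : V → V → ℝ} (hh : IsHeight Γ h) {L : ℝ}
    (hL : ∀ e, |h (G.src e) (G.tgt e)| ≤ L) {x : V} {p : List D} (hp : G.IsPath x p) :
    |h x (G.endpoint x p)| ≤ L * p.length := by
  induction p generalizing x with
  | nil => simp [endpoint, hh.self]
  | cons e p ih =>
    have h1 := ih hp.2
    have h2 := hL e
    rw [hp.1] at h2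
    simp only [endpoint, List.length_cons]
    rw [← hh.add x (G.tgt e)]
    push_cast
    linarith [abs_add_le (h x (G.tgt e)) (h (G.tgt e) (G.endpoint (G.tgt e) p))]

/-- A height function that is not identically zero increases along some edge at every vertex. -/
lemma exists_up_edge (hconn : G.Connected) (hΓ : Γ ≤ G.aut) (htrans : VertexTransitive Γ)
    {h : V → V → ℝ} (hh : IsHeight Γ h) (hne : ∃ x y, h x y ≠ 0) (x : V) :
    ∃ e, G.src e = x ∧ 0 < h x (G.tgt e) := by
  by_contra! hcon
  have h1 : ∀ e, h (G.src e) (G.tgt e) ≤ 0 := by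
    intro e
    obtain ⟨γ, hγ, hx⟩ := htrans (G.src e) x
    have := hcon (γ.2 e) (by rw [(hΓ hγ e).1, hx])
    rwa [G.tgt_map (hΓ hγ), ← hx, hh.inv γ hγ] at this
  have h2 : ∀ e, |h (G.src e) (G.tgt e)| ≤ 0 := by
    intro e
    have h3 := h1 (G.rev e)
    rw [src_rev, tgt_rev, hh.swap] at h3
    exact abs_le.2 ⟨by linarith, h1 e⟩
  obtain ⟨u, v, huv⟩ := hne
  obtain ⟨p, hp, rfl⟩ := hconn u v
  have h3 := abs_height_le hh h2 hp
  rw [zero_mul] at h3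
  exact huv (abs_nonpos_iff.1 h3)

lemma exists_ascending_saw {h : V → V → ℝ} (hh : IsHeight Γ h) {δ : ℝ}
    (hup : ∀ x, ∃ e, G.src e = x ∧ 0 < h x (G.tgt e))
    (hδ : ∀ e, h (G.src e) (G.tgt e) ≠ 0 → δ ≤ |h (G.src e) (G.tgt e)|) (n : ℕ) (x : V) :
    ∃ p, G.IsSAW x p ∧ p.length = n ∧ (∀ e ∈ p, 0 < h x (G.tgt e)) ∧
      n * δ ≤ h x (G.endpoint x p) := by
  induction n generalizing x with
  | zero => exact ⟨[], G.isSAW_nil x, rfl, by simp, by simp [endpoint, hh.self]⟩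
  | succ n ih =>
    obtain ⟨e, rfl, he⟩ := hup x
    obtain ⟨p, hp, hlen, hpos, hend⟩ := ih (G.tgt e)
    have hstep := hδ e he.ne'
    rw [abs_of_pos he] at hstep
    have hpos' : ∀ e' ∈ e :: p, 0 < h (G.src e) (G.tgt e') := by
      intro e' he'
      rcases List.mem_cons.1 he' with rfl | he'
      · exact he
      · rw [← hh.add _ (G.tgt e)]
        linarith [hpos e' he']
    refine ⟨e :: p, ⟨⟨rfl, hp.1⟩, ?_⟩, by simp [hlen], hpos', ?_⟩
    · refine List.nodup_cons.2 ⟨fun hmem => ?_, hp.2⟩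
      obtain ⟨e', he', h'⟩ := List.mem_map.1 hmem
      have := hpos' e' he'
      rw [h', hh.self] at this
      exact lt_irrefl _ this
    · simp only [endpoint]
      rw [← hh.add _ (G.tgt e)]
      push_cast
      linarith

lemma dist_le_length {x : V} {p : List D} (hp : G.IsPath x p) :
    G.dist x (G.endpoint x p) ≤ p.length :=
  Nat.sInf_le ⟨p, hp, rfl, rfl⟩

lemma exists_path_length_eq_dist (hconn : G.Connected) (x y : V) :
    ∃ p, G.IsPath x p ∧ G.endpoint x p = y ∧ p.length = G.dist x y := by
  obtain ⟨p, hp, hxy⟩ := hconn x y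
  exact Nat.sInf_mem (s := {n | ∃ p, G.IsPath x p ∧ G.endpoint x p = y ∧ p.length = n})
    ⟨_, p, hp, hxy, rfl⟩

/-! ### The tilted partition function -/

section Partition

variable {o : V}

lemma finite_sawSet (hloc : G.LocallyFinite) (x : V) (n : ℕ) : (G.sawSet x n).Finite :=
  (finite_paths hloc x n).subset fun _ hp => ⟨hp.1.1, hp.2⟩

lemma modular_rpow_eq (hfin : ∀ x y, (stabOrbit Γ x y).Finite) (lam : ℝ) (x y : V) :
    modular Γ x y ^ lam = Real.exp (lam * logModular Γ x y) := by
  rw [Real.rpow_def_of_pos (modular_pos hfin x y), mul_comm, logModular]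

lemma tiltedZ_eq_sum (hfin : ∀ x y, (stabOrbit Γ x y).Finite) (lam : ℝ) (n : ℕ)
    [Fintype (G.sawSet o n)] :
    G.tiltedZ Γ o lam n =
      ∑ p : G.sawSet o n, Real.exp (lam * logModular Γ o (G.endpoint o p)) := by
  simp only [tiltedZ, tsum_fintype, modular_rpow_eq hfin]

lemma ofReal_pow_mul_tiltedZ (hloc : G.LocallyFinite) (hfin : ∀ x y, (stabOrbit Γ x y).Finite)
    {z : ℝ} (hz : 0 ≤ z) (lam : ℝ) (n : ℕ) :
    ENNReal.ofReal (z ^ n * G.tiltedZ Γ o lam n) =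
      G.gf (logModular Γ) z lam (ofLength G.saw n) o := by
  have := (finite_sawSet hloc o n).fintype
  rw [tiltedZ_eq_sum hfin, Finset.mul_sum, ENNReal.ofReal_sum_of_nonneg (by intros; positivity)]
  have h1 : G.gf (logModular Γ) z lam (ofLength G.saw n) o =
      ∑' p : G.sawSet o n, G.wt (logModular Γ) z lam o p := rfl
  rw [h1, tsum_fintype]
  exact Finset.sum_congr rfl fun p _ => by rw [wt, p.2.2]

lemma tiltedChi_eq_gf (hloc : G.LocallyFinite) (hfin : ∀ x y, (stabOrbit Γ x y).Finite)
    {z : ℝ} (hz : 0 ≤ z) (lam : ℝ) :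
    G.tiltedChi Γ o z lam = G.gf (logModular Γ) z lam G.saw o := by
  rw [gf_eq_tsum_ofLength]
  exact tsum_congr fun n => ofReal_pow_mul_tiltedZ hloc hfin hz lam n

lemma tiltedZ_nonneg (hfin : ∀ x y, (stabOrbit Γ x y).Finite) (lam : ℝ) (n : ℕ) :
    0 ≤ G.tiltedZ Γ o lam n :=
  tsum_nonneg fun _ => (Real.rpow_pos_of_pos (modular_pos hfin _ _) _).le

lemma ofReal_tiltedZ (hloc : G.LocallyFinite) (hfin : ∀ x y, (stabOrbit Γ x y).Finite)
    (lam : ℝ) (n : ℕ) : ENNReal.ofReal (G.tiltedZ Γ o lam n) =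
      G.gf (logModular Γ) 1 lam (ofLength G.saw n) o := by
  rw [← ofReal_pow_mul_tiltedZ hloc hfin zero_le_one, one_pow, one_mul]

lemma tiltedZ_zero (hfin : ∀ x y, (stabOrbit Γ x y).Finite) (lam : ℝ) :
    G.tiltedZ Γ o lam 0 = 1 := by
  have h1 : G.sawSet o 0 = {[]} := by
    ext p
    simp only [sawSet, Set.mem_ofPred_eq, List.length_eq_zero_iff, Set.mem_singleton_iff,
      and_iff_right_iff_imp]
    rintro rfl
    exact G.isSAW_nil o
  rw [tiltedZ, h1, tsum_singleton ([] : List D) fun p => modular Γ o (G.endpoint o p) ^ lam]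
  simp only [endpoint]
  rw [modular_rpow_eq hfin, (isHeight_logModular hfin).self, mul_zero, Real.exp_zero]

lemma tiltedZ_add_le (hloc : G.LocallyFinite) (hΓ : Γ ≤ G.aut) (htrans : VertexTransitive Γ)
    (hfin : ∀ x y, (stabOrbit Γ x y).Finite) (lam : ℝ) (m n : ℕ) :
    G.tiltedZ Γ o lam (m + n) ≤ G.tiltedZ Γ o lam m * G.tiltedZ Γ o lam n := by
  rw [← ENNReal.ofReal_le_ofReal_iff (mul_nonneg (tiltedZ_nonneg hfin _ _) (tiltedZ_nonneg hfin _ _)),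
    ENNReal.ofReal_mul (tiltedZ_nonneg hfin _ _)]
  simp only [ofReal_tiltedZ hloc hfin]
  refine gf_le_mul hΓ htrans (isHeight_logModular hfin) zero_le_one
    ((equivariant_saw hΓ).ofLength n) ?_
  rintro p ⟨hp, hlen⟩
  have hsaw := (G.isSAW_append o (p.take m) (p.drop m)).1 (by rwa [List.take_append_drop])
  exact ⟨p.take m, ⟨hsaw.1, by simp [hlen]⟩, p.drop m, ⟨hsaw.2.1, by simp [hlen]⟩,
    (List.take_append_drop m p).symm⟩

lemma tiltedZ_le_pow (hloc : G.LocallyFinite) (hΓ : Γ ≤ G.aut) (htrans : VertexTransitive Γ)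
    (hfin : ∀ x y, (stabOrbit Γ x y).Finite) (lam : ℝ) (n : ℕ) :
    G.tiltedZ Γ o lam n ≤ G.tiltedZ Γ o lam 1 ^ n := by
  induction n with
  | zero => rw [tiltedZ_zero hfin, pow_zero]
  | succ n ih =>
    refine (tiltedZ_add_le hloc hΓ htrans hfin lam n 1).trans ?_
    rw [pow_succ]
    exact mul_le_mul_of_nonneg_right ih (tiltedZ_nonneg hfin _ _)

lemma exp_height_le_tiltedZ (hloc : G.LocallyFinite) (hfin : ∀ x y, (stabOrbit Γ x y).Finite)
    (lam : ℝ) {p : List D} (hp : G.IsSAW o p) :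
    Real.exp (lam * logModular Γ o (G.endpoint o p)) ≤ G.tiltedZ Γ o lam p.length := by
  have := (finite_sawSet hloc o p.length).fintype
  have hmem : p ∈ G.sawSet o p.length := ⟨hp, rfl⟩
  rw [tiltedZ_eq_sum hfin]
  generalize p.length = n at *
  let f : G.sawSet o n → ℝ := fun q => Real.exp (lam * logModular Γ o (G.endpoint o q))
  have hf : ∀ q ∈ Finset.univ, 0 ≤ f q := fun q _ => (Real.exp_pos _).le
  have h1 := Finset.single_le_sum hf (Finset.mem_univ ⟨p, hmem⟩)
  exact h1

lemma exists_logModular_ne_zero (hfin : ∀ x y, (stabOrbit Γ x y).Finite)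
    (hnonuni : ¬ Unimodular Γ) : ∃ x y, logModular Γ x y ≠ 0 := by
  by_contra! hcon
  refine hnonuni fun x y => ?_
  exact Real.eq_one_of_pos_of_log_eq_zero (modular_pos hfin x y) (hcon x y)

/-- The partition function is bounded below exponentially, because there are self-avoiding walks
of every length. -/
lemma exists_pow_le_tiltedZ (hconn : G.Connected) (hloc : G.LocallyFinite) (hΓ : Γ ≤ G.aut)
    (htrans : VertexTransitive Γ) (hfin : ∀ x y, (stabOrbit Γ x y).Finite)
    (hnonuni : ¬ Unimodular Γ) (lam : ℝ) :
    ∃ K : ℝ, ∀ n : ℕ, Real.exp (-(K * n)) ≤ G.tiltedZ Γ o lam n := by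
  have hh := isHeight_logModular hfin
  obtain ⟨δ, hδ0, L, hL0, hδL⟩ := exists_edge_bounds hloc hΓ htrans hh o
  have hup := exists_up_edge hconn hΓ htrans hh (exists_logModular_ne_zero hfin hnonuni)
  refine ⟨|lam| * L, fun n => ?_⟩
  obtain ⟨p, hp, rfl, -⟩ := exists_ascending_saw hh hup (fun e => (hδL e).2) n o
  refine le_trans (Real.exp_le_exp.2 ?_) (exp_height_le_tiltedZ hloc hfin lam hp)
  have h1 := abs_height_le hh (fun e => (hδL e).1) hp.1
  have h2 : |lam * logModular Γ o (G.endpoint o p)| ≤ |lam| * (L * p.length) := by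
    rw [abs_mul]
    gcongr
  linarith [neg_abs_le (lam * logModular Γ o (G.endpoint o p))]

lemma tiltedZ_one_sub (hloc : G.LocallyFinite) (hΓ : Γ ≤ G.aut) (htrans : VertexTransitive Γ)
    (hfin : ∀ x y, (stabOrbit Γ x y).Finite) (lam : ℝ) (n : ℕ) :
    G.tiltedZ Γ o (1 - lam) n = G.tiltedZ Γ o lam n := by
  have key : ∀ lam lam', lam + lam' = 1 → G.tiltedZ Γ o lam n ≤ G.tiltedZ Γ o lam' n := by
    intro lam lam' hlam
    rw [← ENNReal.ofReal_le_ofReal_iff (tiltedZ_nonneg hfin _ _), ofReal_tiltedZ hloc hfin,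
      ofReal_tiltedZ hloc hfin]
    refine gf_le_gf_of_revPath hΓ htrans hfin zero_le_one hlam
      ((equivariant_saw hΓ).ofLength n) ?_ o
    rintro y p ⟨hp, hlen⟩
    exact ⟨hp.1, G.isSAW_revPath hp, by rwa [length_revPath]⟩
  exact le_antisymm (key _ _ (by ring)) (key _ _ (by ring))

lemma muc_one_sub (hloc : G.LocallyFinite) (hΓ : Γ ≤ G.aut) (htrans : VertexTransitive Γ)
    (hfin : ∀ x y, (stabOrbit Γ x y).Finite) (lam : ℝ) :
    G.muc Γ o (1 - lam) = G.muc Γ o lam := by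
  simp only [muc, tiltedZ_one_sub hloc hΓ htrans hfin]

/-- Fekete's lemma for the partition function. -/
lemma muc_spec (hconn : G.Connected) (hloc : G.LocallyFinite) (hΓ : Γ ≤ G.aut)
    (htrans : VertexTransitive Γ) (hfin : ∀ x y, (stabOrbit Γ x y).Finite)
    (hnonuni : ¬ Unimodular Γ) (lam : ℝ) :
    0 < G.muc Γ o lam ∧
    Tendsto (fun n : ℕ => G.tiltedZ Γ o lam n ^ (1 / (n : ℝ))) atTop (𝓝 (G.muc Γ o lam)) ∧
    ∀ n, G.muc Γ o lam ^ n ≤ G.tiltedZ Γ o lam n := by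
  obtain ⟨K, hK⟩ := exists_pow_le_tiltedZ (o := o) hconn hloc hΓ htrans hfin hnonuni lam
  have hpos : ∀ n, 0 < G.tiltedZ Γ o lam n := fun n => (Real.exp_pos _).trans_le (hK n)
  have hsub : Subadditive fun n => Real.log (G.tiltedZ Γ o lam n) := fun m n => by
    rw [← Real.log_mul (hpos m).ne' (hpos n).ne']
    exact Real.log_le_log (hpos _) (tiltedZ_add_le hloc hΓ htrans hfin lam m n)
  have hbdd : BddBelow (Set.range fun n : ℕ => Real.log (G.tiltedZ Γ o lam n) / n) := by
    refine ⟨-|K|, ?_⟩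
    rintro _ ⟨n, rfl⟩
    have h1 := (Real.le_log_iff_exp_le (hpos n)).2 (hK n)
    rcases Nat.eq_zero_or_pos n with rfl | hn
    · simp
    · have hn' : (0 : ℝ) < n := by exact_mod_cast hn
      simp only
      rw [le_div_iff₀ hn']
      nlinarith [le_abs_self K]
  have hrpow : ∀ n : ℕ, G.tiltedZ Γ o lam n ^ (1 / (n : ℝ)) =
      Real.exp (Real.log (G.tiltedZ Γ o lam n) / n) := fun n => by
    rw [Real.rpow_def_of_pos (hpos n), mul_one_div]
  have htend : Tendsto (fun n : ℕ => G.tiltedZ Γ o lam n ^ (1 / (n : ℝ))) atTop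
      (𝓝 (Real.exp hsub.lim)) := by
    simp only [hrpow]
    exact (Real.continuous_exp.tendsto _).comp (hsub.tendsto_lim hbdd)
  have hle : ∀ n : ℕ, Real.exp hsub.lim ≤ G.tiltedZ Γ o lam (n + 1) ^ (1 / ((n + 1 : ℕ) : ℝ)) := by
    intro n
    rw [hrpow]
    exact Real.exp_le_exp.2 (hsub.lim_le_div hbdd n.succ_ne_zero)
  have hmuc : G.muc Γ o lam = Real.exp hsub.lim := by
    refine le_antisymm ?_ (le_ciInf hle)
    refine ge_of_tendsto' ((tendsto_add_atTop_iff_nat 1).2 htend) fun n => ?_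
    exact ciInf_le ⟨_, Set.forall_mem_range.2 hle⟩ n
  rw [hmuc]
  refine ⟨Real.exp_pos _, htend, fun n => ?_⟩
  rcases n with _ | n
  · rw [pow_zero, tiltedZ_zero hfin]
  · have h1 : Real.exp hsub.lim ^ (n + 1) ≤
        (G.tiltedZ Γ o lam (n + 1) ^ (1 / ((n + 1 : ℕ) : ℝ))) ^ (n + 1) := by
      gcongr
      exact hle n
    rwa [one_div, Real.rpow_inv_natCast_pow (hpos _).le n.succ_ne_zero] at h1

lemma gf_saw_ne_top (hconn : G.Connected) (hloc : G.LocallyFinite) (hΓ : Γ ≤ G.aut)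
    (htrans : VertexTransitive Γ) (hfin : ∀ x y, (stabOrbit Γ x y).Finite)
    (hnonuni : ¬ Unimodular Γ) {z lam : ℝ} (hz : 0 ≤ z) (hzmuc : z * G.muc Γ o lam < 1) :
    G.gf (logModular Γ) z lam G.saw o ≠ ∞ := by
  obtain ⟨hpos, htend, -⟩ := muc_spec (o := o) hconn hloc hΓ htrans hfin hnonuni lam
  obtain ⟨t, ht, hzt⟩ : ∃ t, G.muc Γ o lam < t ∧ z * t < 1 := by
    have hcont : Tendsto (fun t => z * t) (𝓝[>] (G.muc Γ o lam)) (𝓝 (z * G.muc Γ o lam)) :=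
      ((continuous_const_mul z).tendsto _).mono_left nhdsWithin_le_nhds
    obtain ⟨t, h1, h2⟩ := ((hcont.eventually_lt_const hzmuc).and self_mem_nhdsWithin).exists
    exact ⟨t, h2, h1⟩
  have ht0 : 0 < t := hpos.trans ht
  have hsum : Summable fun n => z ^ n * G.tiltedZ Γ o lam n := by
    refine Summable.of_norm_bounded_eventually_nat (g := fun n => (z * t) ^ n)
      (summable_geometric_of_lt_one (by positivity) hzt) ?_
    filter_upwards [htend.eventually_lt_const ht, eventually_ge_atTop 1] with n hn hn1
    have hZ := tiltedZ_nonneg (G := G) (o := o) hfin lam n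
    rw [Real.norm_of_nonneg (by positivity), mul_pow]
    gcongr
    have h1 : (G.tiltedZ Γ o lam n ^ (1 / (n : ℝ))) ^ n ≤ t ^ n := by
      gcongr
    rwa [one_div, Real.rpow_inv_natCast_pow hZ (by omega)] at h1
  rw [← tiltedChi_eq_gf hloc hfin hz]
  exact hsum.tsum_ofReal_ne_top

lemma tsum_ofReal_mul_geometric {C r : ℝ} (hC : 0 ≤ C) (hr0 : 0 ≤ r) (hr1 : r < 1) :
    ∑' n : ℕ, ENNReal.ofReal (C * r ^ n) = ENNReal.ofReal (C / (1 - r)) := by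
  rw [← ENNReal.ofReal_tsum_of_nonneg (fun n => by positivity)
    ((summable_geometric_of_lt_one hr0 hr1).mul_left C), tsum_mul_left,
    tsum_geometric_of_lt_one hr0 hr1, div_eq_mul_inv]

lemma le_tiltedChi (hconn : G.Connected) (hloc : G.LocallyFinite) (hΓ : Γ ≤ G.aut)
    (htrans : VertexTransitive Γ) (hfin : ∀ x y, (stabOrbit Γ x y).Finite)
    (hnonuni : ¬ Unimodular Γ) {z lam : ℝ} (hz : 0 ≤ z) (hzmuc : z * G.muc Γ o lam < 1) :
    ENNReal.ofReal (1 / (1 - z * G.muc Γ o lam)) ≤ G.tiltedChi Γ o z lam := by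
  obtain ⟨hpos, -, hle⟩ := muc_spec (o := o) hconn hloc hΓ htrans hfin hnonuni lam
  rw [← tsum_ofReal_mul_geometric zero_le_one (by positivity) hzmuc]
  refine ENNReal.tsum_le_tsum fun n => ENNReal.ofReal_le_ofReal ?_
  rw [one_mul, mul_pow]
  gcongr
  exact hle n

/-! ### Strict inequality of the critical points -/

/-- The heart of the argument. If `μ_lam ≤ μ_{1/2}`, then below `1 / μ_{1/2}` and at tilt `1/2`
bridges are exponentially rare in their height, with a rate that does not depend on `z`. The
Hammersley–Welsh recursion bounds half-space walks, and thus the susceptibility, uniformly in `z`.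
But the susceptibility diverges at `1 / μ_{1/2}`. -/
lemma muc_half_lt_of_half_lt (hconn : G.Connected) (hloc : G.LocallyFinite) (hΓ : Γ ≤ G.aut)
    (htrans : VertexTransitive Γ) (hfin : ∀ x y, (stabOrbit Γ x y).Finite)
    (hnonuni : ¬ Unimodular Γ) {lam : ℝ} (hlam : 1 / 2 < lam) :
    G.muc Γ o (1 / 2) < G.muc Γ o lam := by
  by_contra! hle
  have hh := isHeight_logModular hfin
  obtain ⟨δ, hδ0, L, hL0, hδL⟩ := exists_edge_bounds hloc hΓ htrans hh o
  have hδ := fun e => (hδL e).2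
  have hδ' : ∀ e, (-logModular Γ) (G.src e) (G.tgt e) ≠ 0 →
      δ ≤ |(-logModular Γ) (G.src e) (G.tgt e)| := by simpa using hδ
  obtain ⟨e, heo, he⟩ := exists_up_edge hconn hΓ htrans hh.neg (by
    simpa using exists_logModular_ne_zero hfin hnonuni) o
  have he' : logModular Γ o (G.tgt e) < 0 := by simpa using he
  set μ := G.muc Γ o (1 / 2)
  have hμ : 0 < μ := (muc_spec (o := o) hconn hloc hΓ htrans hfin hnonuni (1 / 2)).1
  set ρ := Real.exp (-((lam - 1 / 2) * δ)) with hρ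
  have hρ1 : ρ < 1 := Real.exp_zero ▸ Real.exp_lt_exp.2 (by nlinarith)
  set K := 2 * Real.exp (1 / (1 - ρ) ^ 2)
  set c := Real.exp (1 / 2 * logModular Γ o (G.tgt e))
  have hc : 0 < c := Real.exp_pos _
  have hK : 0 < K := by positivity
  have hbound : ∀ z, 0 < z → z * μ < 1 → (z * c) ^ 2 ≤ K ^ 2 * (1 - z * μ) := by
    intro z hz hzμ
    have hsub : 0 < 1 - z * μ := by linarith
    have hfin1 : G.gf (logModular Γ) z (1 / 2) G.saw o ≠ ∞ :=
      gf_saw_ne_top hconn hloc hΓ htrans hfin hnonuni hz.le hzμ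
    have hzlam : z * G.muc Γ o lam < 1 := (mul_le_mul_of_nonneg_left hle hz.le).trans_lt hzμ
    have hfin2 : G.gf (logModular Γ) z lam G.saw o ≠ ∞ :=
      gf_saw_ne_top hconn hloc hΓ htrans hfin hnonuni hz.le hzlam
    have hfin3 : G.gf (-logModular Γ) z (lam - 1) G.saw o ≠ ∞ := by
      rw [show lam - 1 = -(1 - lam) by ring, gf_neg]
      exact gf_saw_ne_top hconn hloc hΓ htrans hfin hnonuni hz.le
        (by rwa [muc_one_sub hloc hΓ htrans hfin])
    have hpow : ∀ k : ℕ, Real.exp (-((lam - 1 / 2) * (k * δ))) = ρ ^ k := fun k => by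
      rw [hρ, ← Real.exp_nat_mul]
      congr 1
      ring
    have hstep : ∀ k : ℕ, ((k + 1 : ℕ) : ℝ) * δ ≤ k * δ + δ := fun k => by
      push_cast
      linarith
    have hup : ∀ k : ℕ, G.gf (logModular Γ) z (1 / 2)
        (G.bridgeIn (logModular Γ) (k * δ) ((k + 1 : ℕ) * δ)) o ≤ ENNReal.ofReal (ρ ^ k) :=
      fun k => (gf_bridgeIn_le_exp hΓ htrans hh hz.le hδ (hstep k) hfin2 hlam.le).trans
        (by rw [hpow])
    have hdown : ∀ k : ℕ, G.gf (-logModular Γ) z (-(1 / 2))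
        (G.bridgeIn (-logModular Γ) (k * δ) ((k + 1 : ℕ) * δ)) o ≤ ENNReal.ofReal (ρ ^ k) :=
      fun k => (gf_bridgeIn_le_exp hΓ htrans hh.neg hz.le hδ' (hstep k) hfin3
        (by linarith)).trans (by
          rw [← hpow, show lam - 1 - -(1 / 2) = lam - 1 / 2 by ring])
    have habove : G.gf (logModular Γ) z (1 / 2) (G.above (-logModular Γ)) o ≤ ENNReal.ofReal K := by
      rw [← gf_neg]
      refine gf_above_le hΓ htrans hh.neg hz.le hδ0 hδ' (Real.exp_pos _).le hρ1
        (by rwa [gf_neg]) hdown fun k => ?_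
      rw [gf_neg, neg_neg]
      exact hup k
    have hbelow := (wt_mul_gf_below_le hΓ htrans hh hz.le (lam := 1 / 2) heo he').trans habove
    have hwt : G.wt (logModular Γ) z (1 / 2) o [e] = ENNReal.ofReal (z * c) := by
      simp [wt, endpoint, c]
    rw [hwt] at hbelow
    have hmax : G.gf (logModular Γ) z (1 / 2) (G.toMax (logModular Γ)) o ≤
        G.gf (logModular Γ) z (1 / 2) (G.below (logModular Γ)) o := by
      refine gf_le_gf_of_revPath hΓ htrans hfin hz.le (by norm_num) (equivariant_toMax hΓ hh) ?_ o
      rintro y p ⟨hp, hp0, hmax⟩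
      refine ⟨hp.1, G.isSAW_revPath hp, fun e' he' => ?_⟩
      have h1 : G.tgt e' ∈ (y :: p.map G.tgt).reverse := by
        rw [← G.vertices_revPath hp.1]
        exact List.mem_cons_of_mem _ (List.mem_map_of_mem he')
      have h2 := hh.add y (G.endpoint y p) (G.tgt e')
      rcases List.mem_cons.1 (List.mem_reverse.1 h1) with h0 | h0
      · rw [h0] at h2 ⊢
        rw [hh.self] at h2
        linarith
      · obtain ⟨e'', he'', h'⟩ := List.mem_map.1 h0
        have h3 := hmax e'' he''
        rw [h'] at h3
        linarith
    have hχ : ENNReal.ofReal (1 / (1 - z * μ)) ≤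
        G.gf (logModular Γ) z (1 / 2) (G.below (logModular Γ)) o ^ 2 := by
      rw [sq]
      refine (le_tiltedChi hconn hloc hΓ htrans hfin hnonuni hz.le hzμ).trans ?_
      rw [tiltedChi_eq_gf hloc hfin hz.le]
      exact (gf_saw_le_mul hΓ htrans hh hz.le).trans (by gcongr)
    have hfinal : ENNReal.ofReal ((z * c) ^ 2 * (1 / (1 - z * μ))) ≤ ENNReal.ofReal (K ^ 2) := by
      rw [ENNReal.ofReal_mul (by positivity), ENNReal.ofReal_pow (by positivity),
        ENNReal.ofReal_pow hK.le]
      calc _ ≤ ENNReal.ofReal (z * c) ^ 2 *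
            G.gf (logModular Γ) z (1 / 2) (G.below (logModular Γ)) o ^ 2 := by gcongr
        _ ≤ _ := by
          rw [← mul_pow]
          gcongr
    rw [ENNReal.ofReal_le_ofReal_iff (by positivity), mul_one_div, div_le_iff₀ hsub] at hfinal
    exact hfinal
  have hlim : ((1 / μ) * c) ^ 2 ≤ K ^ 2 * (1 - (1 / μ) * μ) := by
    have h1 : Tendsto (fun z : ℝ => (z * c) ^ 2) (𝓝[<] (1 / μ)) (𝓝 (((1 / μ) * c) ^ 2)) :=
      (Continuous.tendsto (by fun_prop) _).mono_left nhdsWithin_le_nhds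
    have h2 : Tendsto (fun z : ℝ => K ^ 2 * (1 - z * μ)) (𝓝[<] (1 / μ))
        (𝓝 (K ^ 2 * (1 - (1 / μ) * μ))) :=
      (Continuous.tendsto (by fun_prop) _).mono_left nhdsWithin_le_nhds
    refine le_of_tendsto_of_tendsto h1 h2 ?_
    filter_upwards [Ioo_mem_nhdsLT (show (0 : ℝ) < 1 / μ by positivity)] with z hz
    exact hbound z hz.1 ((lt_div_iff₀ hμ).1 hz.2)
  rw [one_div_mul_cancel hμ.ne', sub_self, mul_zero] at hlim
  have : 0 < ((1 / μ) * c) ^ 2 := by positivity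
  linarith

lemma muc_half_lt (hconn : G.Connected) (hloc : G.LocallyFinite) (hΓ : Γ ≤ G.aut)
    (htrans : VertexTransitive Γ) (hfin : ∀ x y, (stabOrbit Γ x y).Finite)
    (hnonuni : ¬ Unimodular Γ) {lam : ℝ} (hlam : lam ≠ 1 / 2) :
    G.muc Γ o (1 / 2) < G.muc Γ o lam := by
  rcases lt_or_gt_of_ne hlam with h1 | h1
  · rw [← muc_one_sub hloc hΓ htrans hfin lam]
    exact muc_half_lt_of_half_lt hconn hloc hΓ htrans hfin hnonuni (by linarith)
  · exact muc_half_lt_of_half_lt hconn hloc hΓ htrans hfin hnonuni h1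

end Partition

end MGraph

namespace MGraph

variable {V D : Type*} {G : MGraph V D} {Γ : Subgroup (Equiv.Perm V × Equiv.Perm D)} {o : V}

/-! ### Pure exponential growth of the partition function -/

lemma gf_mono_fugacity {h : V → V → ℝ} {z z' lam : ℝ} (hz : 0 ≤ z) (hzz' : z ≤ z')
    (S : V → Set (List D)) (x : V) : G.gf h z lam S x ≤ G.gf h z' lam S x := by
  refine ENNReal.tsum_le_tsum fun p => ENNReal.ofReal_le_ofReal ?_
  gcongr

lemma exists_tiltedZ_le_of_half_lt (hconn : G.Connected) (hloc : G.LocallyFinite)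
    (hΓ : Γ ≤ G.aut) (htrans : VertexTransitive Γ) (hfin : ∀ x y, (stabOrbit Γ x y).Finite)
    (hnonuni : ¬ Unimodular Γ) {lam : ℝ} (hlam : 1 / 2 < lam) :
    ∃ C : ℝ, ∀ n, G.tiltedZ Γ o lam n ≤ C * G.muc Γ o lam ^ n := by
  have hh := isHeight_logModular hfin
  set μ := G.muc Γ o lam
  have hμ : 0 < μ := (muc_spec (o := o) hconn hloc hΓ htrans hfin hnonuni lam).1
  have hlt : G.muc Γ o (1 / 2) < μ := muc_half_lt hconn hloc hΓ htrans hfin hnonuni hlam.ne'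
  set χ := G.gf (logModular Γ) (1 / μ) (1 / 2) G.saw o
  have hχ : χ ≠ ∞ := gf_saw_ne_top hconn hloc hΓ htrans hfin hnonuni (by positivity)
    (by rwa [one_div_mul_eq_div, div_lt_one hμ])
  refine ⟨χ.toReal ^ 2, fun n => ?_⟩
  have hbound : ∀ z, 0 < z → z * μ < 1 → z ^ n * G.tiltedZ Γ o lam n ≤ χ.toReal ^ 2 := by
    intro z hz hzμ
    have h1 : G.gf (logModular Γ) z lam (ofLength G.saw n) o ≤ 1 * χ ^ 2 := by
      refine (gf_saw_ofLength_le hΓ htrans hh hz.le hlam.le (M := 1) (fun m =>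
        gf_bridge_ofLength_le_one hΓ htrans hh hz.le m
          (gf_saw_ne_top hconn hloc hΓ htrans hfin hnonuni hz.le hzμ)) n).trans ?_
      gcongr
      exact gf_mono_fugacity hz.le ((le_div_iff₀ hμ).2 hzμ.le) _ _
    rwa [← ofReal_pow_mul_tiltedZ hloc hfin hz.le, one_mul, ← ENNReal.ofReal_toReal hχ,
      ← ENNReal.ofReal_pow ENNReal.toReal_nonneg, ENNReal.ofReal_le_ofReal_iff (by positivity)]
      at h1
  have hlim : (1 / μ) ^ n * G.tiltedZ Γ o lam n ≤ χ.toReal ^ 2 := by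
    have h1 : Tendsto (fun z : ℝ => z ^ n * G.tiltedZ Γ o lam n) (𝓝[<] (1 / μ))
        (𝓝 ((1 / μ) ^ n * G.tiltedZ Γ o lam n)) :=
      (Continuous.tendsto (by fun_prop) _).mono_left nhdsWithin_le_nhds
    refine le_of_tendsto h1 ?_
    filter_upwards [Ioo_mem_nhdsLT (show (0 : ℝ) < 1 / μ by positivity)] with z hz
    exact hbound z hz.1 ((lt_div_iff₀ hμ).1 hz.2)
  rwa [one_div, inv_pow, inv_mul_le_iff₀ (by positivity), mul_comm] at hlim

lemma exists_tiltedZ_le (hconn : G.Connected) (hloc : G.LocallyFinite)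
    (hΓ : Γ ≤ G.aut) (htrans : VertexTransitive Γ) (hfin : ∀ x y, (stabOrbit Γ x y).Finite)
    (hnonuni : ¬ Unimodular Γ) {lam : ℝ} (hlam : lam ≠ 1 / 2) :
    ∃ C : ℝ, ∀ n, G.tiltedZ Γ o lam n ≤ C * G.muc Γ o lam ^ n := by
  rcases lt_or_gt_of_ne hlam with h1 | h1
  · obtain ⟨C, hC⟩ := exists_tiltedZ_le_of_half_lt (o := o) hconn hloc hΓ htrans hfin hnonuni
      (lam := 1 - lam) (by linarith)
    refine ⟨C, fun n => ?_⟩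
    rw [← tiltedZ_one_sub hloc hΓ htrans hfin, ← muc_one_sub hloc hΓ htrans hfin]
    exact hC n
  · exact exists_tiltedZ_le_of_half_lt hconn hloc hΓ htrans hfin hnonuni h1

/-! ### Exponential decay of the two-point function -/

/-- Of a walk from `o` to `x` and its reversal, one has tilted weight at least `z ^ n`. -/
lemma twoPoint_le_gf (hΓ : Γ ≤ G.aut) (htrans : VertexTransitive Γ)
    (hfin : ∀ x y, (stabOrbit Γ x y).Finite) {z : ℝ} (hz : 0 ≤ z) (x : V) :
    G.twoPoint o z x ≤ G.gf (logModular Γ) z (1 / 2) G.saw o := by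
  have hh := isHeight_logModular hfin
  rcases le_total 0 (logModular Γ o x) with h0 | h0
  · let f : {p : List D // G.IsSAW o p ∧ G.endpoint o p = x} → G.saw o := fun p => ⟨p, p.2.1⟩
    have hf : Function.Injective f := fun p q hpq => Subtype.ext (Subtype.mk.inj hpq)
    refine le_trans (ENNReal.tsum_le_tsum fun p => ?_)
      (ENNReal.tsum_comp_le_tsum_of_injective hf fun p => G.wt (logModular Γ) z (1 / 2) o p)
    refine ENNReal.ofReal_le_ofReal (le_mul_of_one_le_right (by positivity) ?_)
    simp only [f, p.2.2]
    exact Real.one_le_exp (by linarith)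
  · rw [gf_eq_gf hΓ htrans hh (equivariant_saw hΓ) o x]
    have hmem : ∀ p : {p : List D // G.IsSAW o p ∧ G.endpoint o p = x},
        G.revPath p ∈ G.saw x := by
      rintro ⟨p, hp, rfl⟩
      exact G.isSAW_revPath hp
    let f : {p : List D // G.IsSAW o p ∧ G.endpoint o p = x} → G.saw x :=
      fun p => ⟨G.revPath p, hmem p⟩
    have hf : Function.Injective f := fun p q hpq => by
      have h1 : G.revPath p = G.revPath q := Subtype.mk.inj hpq
      exact Subtype.ext (by rw [← G.revPath_revPath p, h1, revPath_revPath])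
    refine le_trans (ENNReal.tsum_le_tsum fun p => ?_)
      (ENNReal.tsum_comp_le_tsum_of_injective hf fun p => G.wt (logModular Γ) z (1 / 2) x p)
    obtain ⟨p, hp, rfl⟩ := p
    simp only [f, wt, length_revPath, G.endpoint_revPath hp.1]
    refine ENNReal.ofReal_le_ofReal (le_mul_of_one_le_right (by positivity) ?_)
    rw [hh.swap o]
    exact Real.one_le_exp (by linarith)

lemma exists_twoPoint_le_exp (hconn : G.Connected) (hloc : G.LocallyFinite)
    (hΓ : Γ ≤ G.aut) (htrans : VertexTransitive Γ) (hfin : ∀ x y, (stabOrbit Γ x y).Finite)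
    (hnonuni : ¬ Unimodular Γ) {z : ℝ} (hz : 0 ≤ z) (hzc : z < G.zc Γ o (1 / 2)) :
    ∃ c : ℝ, 0 < c ∧ ∃ C : ℝ, 0 < C ∧ ∀ x : V,
      G.twoPoint o z x ≤ ENNReal.ofReal (C * Real.exp (-c * (G.dist o x : ℝ))) := by
  have hμ := (muc_spec (o := o) hconn hloc hΓ htrans hfin hnonuni (1 / 2)).1
  -- `z₁` replaces `z` in order to be positive
  obtain ⟨z₁, hz₁, hz₁c⟩ := exists_between hzc
  obtain ⟨z₂, hz₂, hz₂c⟩ := exists_between hz₁c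
  have h₁ : 0 < z₁ := hz.trans_lt hz₁
  have h₂ : 0 < z₂ := h₁.trans hz₂
  set χ := G.gf (logModular Γ) z₂ (1 / 2) G.saw o
  have hχ : χ ≠ ∞ := gf_saw_ne_top hconn hloc hΓ htrans hfin hnonuni h₂.le
    (by rwa [zc, ← one_div, lt_div_iff₀ hμ] at hz₂c)
  have hr : z₁ / z₂ < 1 := (div_lt_one h₂).2 hz₂
  refine ⟨-Real.log (z₁ / z₂), neg_pos.2 (Real.log_neg (by positivity) hr), χ.toReal + 1,
    by positivity, fun x => ?_⟩
  have hexp : Real.exp (- -Real.log (z₁ / z₂) * (G.dist o x : ℝ)) = (z₁ / z₂) ^ G.dist o x := by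
    rw [neg_neg, mul_comm, Real.exp_nat_mul, Real.exp_log (by positivity)]
  rw [hexp]
  calc G.twoPoint o z x
      ≤ ∑' p : {p : List D // G.IsSAW o p ∧ G.endpoint o p = x},
          ENNReal.ofReal ((z₁ / z₂) ^ G.dist o x) * ENNReal.ofReal (z₂ ^ p.1.length) := by
        refine ENNReal.tsum_le_tsum fun p => ?_
        rw [← ENNReal.ofReal_mul (by positivity)]
        refine ENNReal.ofReal_le_ofReal ?_
        obtain ⟨p, hp, rfl⟩ := p
        calc z ^ p.length ≤ z₁ ^ p.length := by gcongr
          _ = (z₁ / z₂) ^ p.length * z₂ ^ p.length := by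
              rw [← mul_pow, div_mul_cancel₀ _ h₂.ne']
          _ ≤ _ := by
              gcongr ?_ * _
              exact pow_le_pow_of_le_one (by positivity) hr.le (dist_le_length hp.1)
    _ = ENNReal.ofReal ((z₁ / z₂) ^ G.dist o x) * G.twoPoint o z₂ x := by
        rw [ENNReal.tsum_mul_left, twoPoint]
    _ ≤ ENNReal.ofReal ((z₁ / z₂) ^ G.dist o x) * ENNReal.ofReal (χ.toReal + 1) := by
        gcongr
        refine (twoPoint_le_gf hΓ htrans hfin h₂.le x).trans ?_
        rw [ENNReal.le_ofReal_iff_toReal_le hχ (by positivity)]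
        exact le_add_of_nonneg_right zero_le_one
    _ = _ := by rw [← ENNReal.ofReal_mul (by positivity), mul_comm]

/-! ### Ballisticity -/

lemma tiltedProb_eq_sum (hfin : ∀ x y, (stabOrbit Γ x y).Finite) (lam : ℝ) (n : ℕ)
    (A : Set (List D)) [Fintype (G.sawSet o n)] :
    G.tiltedProb Γ o lam n A = ∑ p : G.sawSet o n, A.indicator (fun q =>
      (G.tiltedZ Γ o lam n)⁻¹ * Real.exp (lam * logModular Γ o (G.endpoint o q))) p := by
  simp only [tiltedProb, tsum_fintype, modular_rpow_eq hfin]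

lemma tiltedProb_mono (hloc : G.LocallyFinite) (hfin : ∀ x y, (stabOrbit Γ x y).Finite)
    (lam : ℝ) (n : ℕ) {A B : Set (List D)} (hAB : G.sawSet o n ∩ A ⊆ B) :
    G.tiltedProb Γ o lam n A ≤ G.tiltedProb Γ o lam n B := by
  have := (finite_sawSet hloc o n).fintype
  rw [tiltedProb_eq_sum hfin, tiltedProb_eq_sum hfin]
  have hZ := tiltedZ_nonneg (G := G) (o := o) hfin lam n
  refine Finset.sum_le_sum fun p _ => ?_
  by_cases hA : p.1 ∈ A
  · rw [Set.indicator_of_mem hA, Set.indicator_of_mem (hAB ⟨p.2, hA⟩)]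
  · rw [Set.indicator_of_notMem hA]
    exact Set.indicator_nonneg (fun q _ => by positivity) _

/-- Chernoff bound, by comparison with the tilt `lam'`. -/
lemma le_tiltedProb (hloc : G.LocallyFinite) (hfin : ∀ x y, (stabOrbit Γ x y).Finite)
    {lam lam' K : ℝ} {n : ℕ} (hZ : 0 < G.tiltedZ Γ o lam n) (hK : 0 ≤ K) {A : Set (List D)}
    (hA : ∀ p ∈ G.sawSet o n, p ∉ A → Real.exp (lam * logModular Γ o (G.endpoint o p)) ≤
      K * Real.exp (lam' * logModular Γ o (G.endpoint o p))) :
    1 - (G.tiltedZ Γ o lam n)⁻¹ * (K * G.tiltedZ Γ o lam' n) ≤ G.tiltedProb Γ o lam n A := by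
  have := (finite_sawSet hloc o n).fintype
  have h1 : 1 - (G.tiltedZ Γ o lam n)⁻¹ * (K * G.tiltedZ Γ o lam' n) =
      ∑ p : G.sawSet o n, ((G.tiltedZ Γ o lam n)⁻¹ *
        (Real.exp (lam * logModular Γ o (G.endpoint o p)) -
          K * Real.exp (lam' * logModular Γ o (G.endpoint o p)))) := by
    rw [← Finset.mul_sum, Finset.sum_sub_distrib, ← Finset.mul_sum, ← tiltedZ_eq_sum hfin,
      ← tiltedZ_eq_sum hfin, mul_sub, inv_mul_cancel₀ hZ.ne']
  rw [h1, tiltedProb_eq_sum hfin]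
  refine Finset.sum_le_sum fun p _ => ?_
  by_cases hp : p.1 ∈ A
  · rw [Set.indicator_of_mem hp]
    gcongr
    exact sub_le_self _ (by positivity)
  · rw [Set.indicator_of_notMem hp]
    exact mul_nonpos_of_nonneg_of_nonpos (by positivity) (sub_nonpos.2 (hA p p.2 hp))

lemma inv_mul_exp_le_tiltedProb (hloc : G.LocallyFinite)
    (hfin : ∀ x y, (stabOrbit Γ x y).Finite) {lam : ℝ} {n : ℕ} {A : Set (List D)} {p : List D}
    (hp : p ∈ G.sawSet o n) (hpA : p ∈ A) :
    (G.tiltedZ Γ o lam n)⁻¹ * Real.exp (lam * logModular Γ o (G.endpoint o p)) ≤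
      G.tiltedProb Γ o lam n A := by
  have := (finite_sawSet hloc o n).fintype
  have hZ := tiltedZ_nonneg (G := G) (o := o) hfin lam n
  rw [tiltedProb_eq_sum hfin]
  let f : List D → ℝ := A.indicator fun q =>
    (G.tiltedZ Γ o lam n)⁻¹ * Real.exp (lam * logModular Γ o (G.endpoint o q))
  have h1 : f p = (G.tiltedZ Γ o lam n)⁻¹ * Real.exp (lam * logModular Γ o (G.endpoint o p)) :=
    Set.indicator_of_mem hpA _
  have hf : ∀ q ∈ (Finset.univ : Finset (G.sawSet o n)), 0 ≤ f q := fun q _ =>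
    Set.indicator_nonneg (fun q _ => by positivity) _
  have h2 := Finset.single_le_sum hf (Finset.mem_univ ⟨p, hp⟩)
  exact h1.ge.trans h2

/-- An exponential bound with a prefactor `K` decides the large `n`, and the crude bound `p ^ n`
the remaining ones. -/
lemma exists_rate {K τ a p δ : ℝ} (hτ : 0 < τ) (ha : 0 ≤ a) (hp0 : 0 < p)
    (hp1 : p ≤ 1) (hδ : 0 < δ) :
    ∃ c : ℝ, 0 < c ∧ c ≤ δ ∧ ∀ (n : ℕ) (P : ℝ), 1 - K * Real.exp (-(τ * n) + a * (c * n)) ≤ P →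
      p ^ n ≤ P → 1 - Real.exp (-c * n) ≤ P := by
  obtain ⟨N, hN⟩ := exists_nat_gt (2 * K / τ)
  have hKN : ∀ n : ℕ, N ≤ n → K ≤ Real.exp (τ / 2 * n) := by
    intro n hn
    have h1 : (N : ℝ) ≤ n := by exact_mod_cast hn
    have h2 := (div_lt_iff₀ hτ).1 hN
    have h3 := Real.add_one_le_exp (τ / 2 * n)
    nlinarith
  set c := min (τ / (2 * (1 + a))) (min (p ^ N / (N + 1)) δ)
  have hc : 0 < c := by positivity
  have hc1 : (1 + a) * c ≤ τ / 2 := by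
    have h1 : c ≤ τ / (2 * (1 + a)) := min_le_left _ _
    calc (1 + a) * c ≤ (1 + a) * (τ / (2 * (1 + a))) := by gcongr
      _ = τ / 2 := by field_simp
  have hc2 : c * (N + 1) ≤ p ^ N := by
    have h1 : c ≤ p ^ N / (N + 1) := (min_le_right _ _).trans (min_le_left _ _)
    rwa [le_div_iff₀ (by positivity)] at h1
  refine ⟨c, hc, (min_le_right _ _).trans (min_le_right _ _), fun n P h1 h2 => ?_⟩
  have hn0 : (0 : ℝ) ≤ n := n.cast_nonneg
  rcases le_total N n with hn | hn
  · refine le_trans ?_ h1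
    have h3 : K * Real.exp (-(τ * n) + a * (c * n)) ≤ Real.exp (-c * n) := by
      calc K * Real.exp (-(τ * n) + a * (c * n))
          ≤ Real.exp (τ / 2 * n) * Real.exp (-(τ * n) + a * (c * n)) := by
            gcongr
            exact hKN n hn
        _ = Real.exp (τ / 2 * n + (-(τ * n) + a * (c * n))) := (Real.exp_add _ _).symm
        _ ≤ _ := by
            gcongr
            nlinarith
    linarith
  · have h3 : p ^ N ≤ p ^ n := pow_le_pow_of_le_one hp0.le hp1 hn
    have h4 : (n : ℝ) ≤ N := by exact_mod_cast hn
    have h5 := Real.add_one_le_exp (-c * n)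
    nlinarith

/-- Chernoff's bound compares the tilt `lam` with the tilt `1/2`, whose growth rate is strictly
smaller. For small `n` a single monotone walk has enough weight. -/
lemma exists_ballistic_logModular (hconn : G.Connected) (hloc : G.LocallyFinite)
    (hΓ : Γ ≤ G.aut) (htrans : VertexTransitive Γ) (hfin : ∀ x y, (stabOrbit Γ x y).Finite)
    (hnonuni : ¬ Unimodular Γ) {lam : ℝ} (hlam : lam ≠ 1 / 2) :
    ∃ c : ℝ, 0 < c ∧ ∀ n : ℕ, 1 - Real.exp (-c * (n : ℝ)) ≤ G.tiltedProb Γ o lam n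
      {p | c * (n : ℝ) ≤ Real.sign (lam - 1 / 2) * logModular Γ o (G.endpoint o p)} := by
  have hh := isHeight_logModular hfin
  obtain ⟨δ, hδ0, L, hL0, hδL⟩ := exists_edge_bounds hloc hΓ htrans hh o
  have hne := exists_logModular_ne_zero hfin hnonuni
  set s := Real.sign (lam - 1 / 2) with hs
  have hwalk : ∀ n : ℕ, ∃ p ∈ G.sawSet o n, n * δ ≤ s * logModular Γ o (G.endpoint o p) := by
    intro n
    rcases lt_or_gt_of_ne hlam with h1 | h1
    · obtain ⟨p, hp, hlen, -, hend⟩ := exists_ascending_saw hh.neg (δ := δ)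
        (exists_up_edge hconn hΓ htrans hh.neg (by simpa using hne))
        (by simpa using fun e => (hδL e).2) n o
      refine ⟨p, ⟨hp, hlen⟩, ?_⟩
      rw [hs, Real.sign_of_neg (by linarith)]
      simpa using hend
    · obtain ⟨p, hp, hlen, -, hend⟩ := exists_ascending_saw hh
        (exists_up_edge hconn hΓ htrans hh hne) (fun e => (hδL e).2) n o
      refine ⟨p, ⟨hp, hlen⟩, ?_⟩
      rwa [hs, Real.sign_of_pos (by linarith), one_mul]
  have habs : lam - 1 / 2 = |lam - 1 / 2| * s := by
    rcases lt_or_gt_of_ne hlam with h1 | h1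
    · rw [hs, Real.sign_of_neg (by linarith), abs_of_neg (by linarith)]
      ring
    · rw [hs, Real.sign_of_pos (by linarith), abs_of_pos (by linarith), mul_one]
  set a := |lam - 1 / 2|
  have ha : 0 ≤ a := abs_nonneg _
  obtain ⟨hμ, -, hμle⟩ := muc_spec (o := o) hconn hloc hΓ htrans hfin hnonuni lam
  have hμ' := (muc_spec (o := o) hconn hloc hΓ htrans hfin hnonuni (1 / 2)).1
  set μ := G.muc Γ o lam
  have hZ : ∀ n, 0 < G.tiltedZ Γ o lam n := fun n => (pow_pos hμ n).trans_le (hμle n)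
  obtain ⟨t, hμt, htμ⟩ := exists_between (muc_half_lt (o := o) hconn hloc hΓ htrans hfin hnonuni hlam)
  have ht : 0 < t := hμ'.trans hμt
  set χ := G.gf (logModular Γ) (1 / t) (1 / 2) G.saw o
  have hχ : χ ≠ ∞ := gf_saw_ne_top hconn hloc hΓ htrans hfin hnonuni (by positivity)
    (by rwa [one_div_mul_eq_div, div_lt_one ht])
  have hhalf : ∀ n, G.tiltedZ Γ o (1 / 2) n ≤ χ.toReal * t ^ n := by
    intro n
    have h1 : ENNReal.ofReal ((1 / t) ^ n * G.tiltedZ Γ o (1 / 2) n) ≤ χ := by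
      rw [ofReal_pow_mul_tiltedZ hloc hfin (by positivity)]
      exact gf_mono fun p hp => hp.1
    rw [ENNReal.ofReal_le_iff_le_toReal hχ, one_div, inv_pow, inv_mul_le_iff₀ (by positivity),
      mul_comm] at h1
    exact h1
  set τ := Real.log (μ / t) with hτ
  have hτ0 : 0 < τ := Real.log_pos ((one_lt_div ht).2 htμ)
  have hτexp : ∀ n : ℕ, Real.exp (-(τ * n)) = (μ ^ n)⁻¹ * t ^ n := fun n => by
    rw [mul_comm, Real.exp_neg, Real.exp_nat_mul, hτ, Real.exp_log (by positivity), div_pow,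
      inv_div, div_eq_inv_mul]
  set p := min 1 (Real.exp (-(|lam| * L)) / G.tiltedZ Γ o lam 1)
  have hp0 : 0 < p := lt_min one_pos (div_pos (Real.exp_pos _) (hZ 1))
  obtain ⟨c, hc, hcδ, hrate⟩ := exists_rate (K := χ.toReal) hτ0 ha hp0 (min_le_left _ _) hδ0
  refine ⟨c, hc, fun n => hrate n _ ?_ ?_⟩
  · have h1 := le_tiltedProb (lam' := 1 / 2) (K := Real.exp (a * (c * n))) hloc hfin (hZ n)
      (Real.exp_pos _).le (A := {p | c * (n : ℝ) ≤ s * logModular Γ o (G.endpoint o p)}) (by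
        intro q _ hq
        have hq : s * logModular Γ o (G.endpoint o q) < c * n := not_le.1 hq
        rw [← Real.exp_add]
        refine Real.exp_le_exp.2 ?_
        have h2 : lam * logModular Γ o (G.endpoint o q) =
            1 / 2 * logModular Γ o (G.endpoint o q) +
              a * (s * logModular Γ o (G.endpoint o q)) := by
          linear_combination logModular Γ o (G.endpoint o q) * habs
        rw [h2]
        nlinarith)
    refine le_trans ?_ h1
    rw [Real.exp_add, hτexp]
    have h2 : (G.tiltedZ Γ o lam n)⁻¹ * (Real.exp (a * (c * n)) * G.tiltedZ Γ o (1 / 2) n) ≤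
        (μ ^ n)⁻¹ * (Real.exp (a * (c * n)) * (χ.toReal * t ^ n)) := by
      have h3 := tiltedZ_nonneg (G := G) (o := o) hfin (1 / 2) n
      gcongr
      · exact hμle n
      · exact hhalf n
    linarith
  · obtain ⟨q, hq, hqs⟩ := hwalk n
    refine le_trans ?_ (inv_mul_exp_le_tiltedProb hloc hfin hq
      (le_trans (by nlinarith [(n.cast_nonneg : (0 : ℝ) ≤ n)]) hqs))
    have h1 : Real.exp (-(|lam| * L)) ^ n ≤
        Real.exp (lam * logModular Γ o (G.endpoint o q)) := by
      rw [← Real.exp_nat_mul]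
      refine Real.exp_le_exp.2 ?_
      have h2 := abs_height_le hh (fun e => (hδL e).1) hq.1.1
      rw [hq.2] at h2
      have h3 : |lam * logModular Γ o (G.endpoint o q)| ≤ |lam| * (L * n) := by
        rw [abs_mul]
        gcongr
      linarith [neg_abs_le (lam * logModular Γ o (G.endpoint o q))]
    calc p ^ n ≤ (Real.exp (-(|lam| * L)) / G.tiltedZ Γ o lam 1) ^ n := by
          gcongr
          exact min_le_right _ _
      _ = (G.tiltedZ Γ o lam 1 ^ n)⁻¹ * Real.exp (-(|lam| * L)) ^ n := by
          rw [div_pow, div_eq_inv_mul]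
      _ ≤ _ := by
          gcongr
          · exact inv_nonneg.2 (hZ n).le
          · exact hZ n
          · exact tiltedZ_le_pow hloc hΓ htrans hfin lam n

end MGraph

theorem theorem1p4 {V D : Type*} (G : MGraph V D)
    (hconn : G.Connected) (hfin : G.LocallyFinite)
    (Γ : Subgroup (Equiv.Perm V × Equiv.Perm D)) (hΓ : Γ ≤ G.aut)
    (htrans : VertexTransitive Γ) (hnonuni : ¬ Unimodular Γ) (o : V) :
    -- the limit defining `μ_{c,lam}` exists, is the infimum, and is positive
    (∀ lam : ℝ, 0 < G.muc Γ o lam ∧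
      Tendsto (fun n : ℕ => G.tiltedZ Γ o lam n ^ (1 / (n : ℝ))) atTop (𝓝 (G.muc Γ o lam))) ∧
    -- (1)
    (∀ lam : ℝ, lam ≠ 1 / 2 → ∃ C : ℝ, 0 < C ∧
      (∀ z : ℝ, 0 < z → z < G.zc Γ o lam →
        ENNReal.ofReal (G.zc Γ o lam / (G.zc Γ o lam - z)) ≤ G.tiltedChi Γ o z lam ∧
        G.tiltedChi Γ o z lam ≤ ENNReal.ofReal (C * G.zc Γ o lam / (G.zc Γ o lam - z))) ∧
      (∀ n : ℕ, G.muc Γ o lam ^ n ≤ G.tiltedZ Γ o lam n ∧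
        G.tiltedZ Γ o lam n ≤ C * G.muc Γ o lam ^ n)) ∧
    -- (2)
    (∀ z : ℝ, 0 ≤ z → z < G.zc Γ o (1 / 2) → ∃ c : ℝ, 0 < c ∧ ∃ C : ℝ, 0 < C ∧
      ∀ x : V, G.twoPoint o z x ≤ ENNReal.ofReal (C * Real.exp (-c * (G.dist o x : ℝ)))) ∧
    -- (3)
    (∀ lam : ℝ, lam ≠ 1 / 2 →
      (∃ c : ℝ, 0 < c ∧ ∀ n : ℕ,
        1 - Real.exp (-c * (n : ℝ)) ≤ G.tiltedProb Γ o lam n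
          {p | c * (n : ℝ) ≤
            Real.sign (lam - 1 / 2) * Real.log (modular Γ o (G.endpoint o p))}) ∧
      (∃ c' : ℝ, 0 < c' ∧ ∀ n : ℕ,
        1 - Real.exp (-c' * (n : ℝ)) ≤ G.tiltedProb Γ o lam n
          {p | c' * (n : ℝ) ≤ (G.dist o (G.endpoint o p) : ℝ)})) := by
  have horb := fun x y => MGraph.finite_stabOrbit (Γ := Γ) hconn hfin hΓ x y
  have hspec := MGraph.muc_spec (o := o) hconn hfin hΓ htrans horb hnonuni
  have hh := MGraph.isHeight_logModular horb
  refine ⟨fun lam => ⟨(hspec lam).1, (hspec lam).2.1⟩, fun lam hlam => ?_,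
    fun z hz hzc => MGraph.exists_twoPoint_le_exp hconn hfin hΓ htrans horb hnonuni hz hzc,
    fun lam hlam => ?_⟩
  · obtain ⟨C, hC⟩ := MGraph.exists_tiltedZ_le (o := o) hconn hfin hΓ htrans horb hnonuni hlam
    obtain ⟨hμ, -, hle⟩ := hspec lam
    have hC1 : 1 ≤ C := by simpa using (hle 0).trans (hC 0)
    have hC0 : 0 < C := by linarith
    refine ⟨C, hC0, fun z hz hzc => ?_, fun n => ⟨hle n, hC n⟩⟩
    rw [MGraph.zc, ← one_div, lt_div_iff₀ hμ] at hzc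
    have hsub : 1 - z * G.muc Γ o lam ≠ 0 := by linarith
    have hzc_eq : G.zc Γ o lam / (G.zc Γ o lam - z) = 1 / (1 - z * G.muc Γ o lam) := by
      have hzc_mul : G.zc Γ o lam * (1 - z * G.muc Γ o lam) = G.zc Γ o lam - z := by
        rw [MGraph.zc]
        field_simp
      rw [← hzc_mul, MGraph.zc, div_mul_cancel_left₀ (inv_ne_zero hμ.ne'), one_div]
    rw [mul_div_assoc, hzc_eq]
    refine ⟨MGraph.le_tiltedChi hconn hfin hΓ htrans horb hnonuni hz.le hzc, ?_⟩
    rw [mul_one_div, ← MGraph.tsum_ofReal_mul_geometric hC0.le (by positivity) hzc]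
    refine ENNReal.tsum_le_tsum fun n => ENNReal.ofReal_le_ofReal ?_
    rw [mul_pow, mul_left_comm]
    gcongr
    exact hC n
  · obtain ⟨c, hc, hball⟩ :=
      MGraph.exists_ballistic_logModular (o := o) hconn hfin hΓ htrans horb hnonuni hlam
    obtain ⟨δ, hδ0, L, hL0, hδL⟩ := MGraph.exists_edge_bounds hfin hΓ htrans hh o
    refine ⟨⟨c, hc, hball⟩, min c (c / L), by positivity, fun n => ?_⟩
    refine le_trans ?_ ((hball n).trans (MGraph.tiltedProb_mono hfin horb lam n ?_))
    · have : min c (c / L) ≤ c := min_le_left _ _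
      gcongr
    · rintro p ⟨-, hp⟩
      have hp : c * (n : ℝ) ≤
        Real.sign (lam - 1 / 2) * MGraph.logModular Γ o (G.endpoint o p) := hp
      obtain ⟨q, hq, hqend, hqlen⟩ := MGraph.exists_path_length_eq_dist hconn o (G.endpoint o p)
      have h1 := MGraph.abs_height_le hh (fun e => (hδL e).1) hq
      rw [hqend, hqlen] at h1
      have h2 : Real.sign (lam - 1 / 2) * MGraph.logModular Γ o (G.endpoint o p) ≤
          |MGraph.logModular Γ o (G.endpoint o p)| := by
        rcases lt_or_gt_of_ne hlam with h0 | h0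
        · rw [Real.sign_of_neg (by linarith), neg_one_mul]
          exact neg_le_abs _
        · rw [Real.sign_of_pos (by linarith), one_mul]
          exact le_abs_self _
      have h3 : c * n ≤ L * G.dist o (G.endpoint o p) := hp.trans (h2.trans h1)
      change min c (c / L) * (n : ℝ) ≤ (G.dist o (G.endpoint o p) : ℝ)
      calc min c (c / L) * (n : ℝ) ≤ c / L * n := by
            gcongr
            exact min_le_right _ _
        _ = c * n / L := by ring
        _ ≤ _ := by rwa [div_le_iff₀ hL0, mul_comm (G.dist o (G.endpoint o p) : ℝ)]
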